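/- Let $5/3<\gamma\le 2$, $L>1$, and on the phase space $\Omega=\{(x,z):x>0,\ z>0\}$ let $f(z)=1+z^{\gamma-1}$, $\nu(z)^2=(\gamma-1)\frac{z^{\gamma-1}}{1+z^{\gamma-1}}$ with $\nu\ge 0$, $w=\frac{d\log\nu}{d\log z}$, and $$H_L(x,z)=x^4z^2\Big(\frac{L^2}{f(z)^2}-1+\frac1x\Big).$$ Consider the flow $$\frac{dx}{dl}=\frac{2f^2}{z}\Big[\nu^2\Big(1-\frac1x+u^2\Big)-u^2\Big],\qquad \frac{dz}{dl}=\frac{f^2}{x}\Big(4u^2-\frac1x\Big),\qquad u^2:=\frac{L^2}{f(z)^2}-1+\frac1x ,$$ which has the same orbits as the Hamiltonian system $\frac{dx}{d\tilde l}=\frac{\partial H_L}{\partial z}$, $\frac{dz}{d\tilde l}=-\frac{\partial H_L}{\partial x}$, run through in the opposite direction. Let $c_1$ be the curve $x=\frac34\big[1-\frac{L^2}{f(z)^2}\big]^{-1}$, $z>0$, $f(z)>L$ (where $\partial H_L/\partial x=0$), and $c_2$ the curve $x=\big[1-\frac{L^2}{f(z)^2}(1-\nu(z)^2)\big]^{-1}$,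 $z>0$, $f(z)>L\sqrt{1-\nu(z)^2}$ (where $\partial H_L/\partial z=0$). A point lies above (below) such a curve if the curve has a point with the same $x$, and every such point has a smaller (larger) $z$. Then $H_L$ has exactly one critical point $(x_c,z_c)$ in $\Omega$; it is a saddle (the Hessian of $H_L$ there has negative determinant), and $x_c>1$. Let $\Gamma_+$ and $\Gamma_-$ be its unstable and stable manifolds in $\Omega$ for the flow in the parameter $l$ (the sets of points whose backward, respectively forward, orbit stays in $\Omega$ and converges to $(x_c,z_c)$); equivalently, they are its stable and unstable manifolds, respectively, for the Hamiltonian system in the parameter $\tilde l$. Moreover: (a) $\Gamma_+\cap\{x\ge 1\}$ is the graph of a differentiable function $z_+$ on $[1,\infty)$, so it reaches the horizon $x=1$ on one side of $x_c$ and extends to $x\to\infty$ on the other; for every $x>x_c$ the point $(x,z_+(x))$ lies above $c_1$; and $$z_+'(x_c)=\frac{z_c}{x_c}\,\frac{-2+\sqrt{1+3\nu_c^2-3w_c}}{1-\nu_c^2+w_c},\qquad \nu_c=\nu(z_c),\ w_c=w(z_c).$$ (b) $\Gamma_-$ is the graph of a differentiable function $z_-$ on $(1,\infty)$; it asymptotes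 to the horizon, $z_-(x)\to\infty$ as $x\to 1^+$; for every $x>x_c$ the point $(x,z_-(x))$ lies below $c_2$; and $$z_-'(x_c)=\frac{z_c}{x_c}\,\frac{-2-\sqrt{1+3\nu_c^2-3w_c}}{1-\nu_c^2+w_c}.$$ (c) $\Gamma_+$ describes a global accretion flow from the horizon to infinity: there are a constant $\mu<0$ with $\mu^2=H_L(x_c,z_c)$ and a differentiable function $u<0$ on $[1,\infty)$ such that $z_+>0$, $$x^2z_+(x)u(x)=\mu,\qquad f(z_+(x))^2\Big(1-\frac1x+u(x)^2\Big)=L^2\qquad\text{for all }x\ge 1,$$ and $z_+(x)$ converges, as $x\to\infty$, to some $z_\infty>0$ with $f(z_\infty)=L$. -/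

import Mathlib

open Set Filter Topology

namespace Michel

noncomputable section

/-- The phase space `Ω = {(x, z) : x > 0, z > 0}`. -/
def phaseSpace : Set (ℝ × ℝ) := {p | 0 < p.1 ∧ 0 < p.2}

/-- The dimensionless specific enthalpy of a polytrope of adiabatic index `γ`. -/
def f (γ z : ℝ) : ℝ := 1 + z ^ (γ - 1)

/-- The sound speed of a polytrope. -/
def nu (γ z : ℝ) : ℝ := Real.sqrt ((γ - 1) * (z ^ (γ - 1) / (1 + z ^ (γ - 1))))

/-- The logarithmic derivative `w = ∂ log ν / ∂ log z`. -/
def w (γ z : ℝ) : ℝ := z * deriv (nu γ) z / nu γ z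

/-- The Hamiltonian `H_L`. -/
def H (γ L x z : ℝ) : ℝ := x ^ 4 * z ^ 2 * (L ^ 2 / f γ z ^ 2 - 1 + 1 / x)

/-- The Hamiltonian vector field `(∂H_L/∂z, -∂H_L/∂x)`, governing the parameter `l̃`. -/
def hamField (γ L : ℝ) (p : ℝ × ℝ) : ℝ × ℝ :=
  (deriv (fun z => H γ L p.1 z) p.2, - deriv (fun x => H γ L x p.2) p.1)

/-- The square of the radial velocity at fixed `L`, as a function of `(x, z)`. -/
def uSq (γ L x z : ℝ) : ℝ := L ^ 2 / f γ z ^ 2 - 1 + 1 / x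

/-- The same flow in the parameter `l`, obtained by differentiating the conservation laws.  It is
a multiple of `hamField` by a negative function on the phase space, see `flowField_eq`: the two
systems have the same orbits, run through in opposite directions. -/
def flowField (γ L : ℝ) (p : ℝ × ℝ) : ℝ × ℝ :=
  (2 * f γ p.2 ^ 2 / p.2 *
      (nu γ p.2 ^ 2 * (1 - 1 / p.1 + uSq γ L p.1 p.2) - uSq γ L p.1 p.2),
    f γ p.2 ^ 2 / p.1 * (4 * uSq γ L p.1 p.2 - 1 / p.1))

/-- Critical points of `H_L` in the phase space. -/
def IsCritical (γ L : ℝ) (p : ℝ × ℝ) : Prop :=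
  p ∈ phaseSpace ∧ deriv (fun x => H γ L x p.2) p.1 = 0 ∧ deriv (fun z => H γ L p.1 z) p.2 = 0

/-- The determinant of the Hessian of `H_L`. -/
def hessDet (γ L : ℝ) (p : ℝ × ℝ) : ℝ :=
  deriv (fun x => deriv (fun x' => H γ L x' p.2) x) p.1 *
      deriv (fun z => deriv (fun z' => H γ L p.1 z') z) p.2 -
    deriv (fun x => deriv (fun z => H γ L x z) p.2) p.1 *
      deriv (fun z => deriv (fun x => H γ L x z) p.1) p.2

/-- Saddle points of `H_L`: critical points at which the Hessian is indefinite. -/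
def IsSaddle (γ L : ℝ) (p : ℝ × ℝ) : Prop := IsCritical γ L p ∧ hessDet γ L p < 0

/-- The stable manifold of `p` in the open set `U`: the points whose forward orbit under the
vector field `V` stays in `U` and converges to `p`. -/
def stableManifold (U : Set (ℝ × ℝ)) (V : ℝ × ℝ → ℝ × ℝ) (p : ℝ × ℝ) : Set (ℝ × ℝ) :=
  {q | ∃ φ : ℝ → ℝ × ℝ, φ 0 = q ∧ IsIntegralCurveOn φ (fun _ => V) (Ici 0) ∧
    (∀ t ∈ Ici (0 : ℝ), φ t ∈ U) ∧ Tendsto φ atTop (𝓝 p)}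

/-- The unstable manifold of `p` in the open set `U`: the points whose backward orbit under the
vector field `V` stays in `U` and converges to `p`. -/
def unstableManifold (U : Set (ℝ × ℝ)) (V : ℝ × ℝ → ℝ × ℝ) (p : ℝ × ℝ) : Set (ℝ × ℝ) :=
  {q | ∃ φ : ℝ → ℝ × ℝ, φ 0 = q ∧ IsIntegralCurveOn φ (fun _ => V) (Iic 0) ∧
    (∀ t ∈ Iic (0 : ℝ), φ t ∈ U) ∧ Tendsto φ atBot (𝓝 p)}

/-- `Γ₊`, the unstable manifold in the parameter `l`. -/
def GammaPlus (γ L : ℝ) (p : ℝ × ℝ) : Set (ℝ × ℝ) :=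
  unstableManifold phaseSpace (flowField γ L) p

/-- `Γ₋`, the stable manifold in the parameter `l`. -/
def GammaMinus (γ L : ℝ) (p : ℝ × ℝ) : Set (ℝ × ℝ) :=
  stableManifold phaseSpace (flowField γ L) p

/-- The slope `dz₊/dx` at a saddle point `(x, z)`. -/
def slopePlus (γ : ℝ) (p : ℝ × ℝ) : ℝ :=
  p.2 / p.1 * ((-2 + Real.sqrt (1 + 3 * nu γ p.2 ^ 2 - 3 * w γ p.2)) /
    (1 - nu γ p.2 ^ 2 + w γ p.2))

/-- The slope `dz₋/dx` at a saddle point `(x, z)`. -/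
def slopeMinus (γ : ℝ) (p : ℝ × ℝ) : ℝ :=
  p.2 / p.1 * ((-2 - Real.sqrt (1 + 3 * nu γ p.2 ^ 2 - 3 * w γ p.2)) /
    (1 - nu γ p.2 ^ 2 + w γ p.2))

/-- The curve `c₁`, on which `∂H_L/∂x = 0`. -/
def c1 (γ L : ℝ) : Set (ℝ × ℝ) :=
  {p | 0 < p.2 ∧ L < f γ p.2 ∧ p.1 = 3 / 4 * (1 - L ^ 2 / f γ p.2 ^ 2)⁻¹}

/-- The curve `c₂`, on which `∂H_L/∂z = 0`. -/
def c2 (γ L : ℝ) : Set (ℝ × ℝ) :=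
  {p | 0 < p.2 ∧ L * Real.sqrt (1 - nu γ p.2 ^ 2) < f γ p.2 ∧
    p.1 = (1 - L ^ 2 / f γ p.2 ^ 2 * (1 - nu γ p.2 ^ 2))⁻¹}

/-- `p` lies above the curve `c`: the curve passes over the abscissa of `p`, and only below `p`. -/
def LiesAbove (p : ℝ × ℝ) (c : Set (ℝ × ℝ)) : Prop :=
  (∃ z, (p.1, z) ∈ c) ∧ ∀ z, (p.1, z) ∈ c → z < p.2

/-- `p` lies below the curve `c`: the curve passes over the abscissa of `p`, and only above `p`. -/
def LiesBelow (p : ℝ × ℝ) (c : Set (ℝ × ℝ)) : Prop :=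
  (∃ z, (p.1, z) ∈ c) ∧ ∀ z, (p.1, z) ∈ c → p.2 < z

/-- A steady accretion flow from the horizon `x = 1` to infinity: a density `z` and a radial
velocity `u < 0` on `[1, ∞)`, differentiable, obeying the conservation of particle flux and
of energy flux with constants `μ` and `L`. -/
structure IsGlobalAccretionFlow (γ L μ : ℝ) (z u : ℝ → ℝ) : Prop where
  density_diff : DifferentiableOn ℝ z (Ici 1)
  velocity_diff : DifferentiableOn ℝ u (Ici 1)
  density_pos : ∀ x ∈ Ici (1 : ℝ), 0 < z x
  velocity_neg : ∀ x ∈ Ici (1 : ℝ), u x < 0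
  particle_flux : ∀ x ∈ Ici (1 : ℝ), x ^ 2 * z x * u x = μ
  energy_flux : ∀ x ∈ Ici (1 : ℝ), f γ (z x) ^ 2 * (1 - 1 / x + u x ^ 2) = L ^ 2

end

theorem flowField_eq {γ L : ℝ} (hγ : 1 ≤ γ) {p : ℝ × ℝ} (hp : p ∈ phaseSpace) :
    flowField γ L p = (-(f γ p.2 ^ 2 / (p.1 ^ 4 * p.2 ^ 2))) • hamField γ L p := by
  obtain ⟨x, z⟩ := p
  obtain ⟨hx, hz⟩ := hp
  simp only at hx hz
  have hs : 0 < z ^ (γ - 1) := Real.rpow_pos_of_pos hz _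
  have hf : 0 < f γ z := by unfold f; linarith
  have hfd : HasDerivAt (f γ) ((γ - 1) * z ^ (γ - 1) / z) z := by
    have h := (Real.hasDerivAt_rpow_const (x := z) (p := γ - 1) (Or.inl hz.ne')).const_add 1
    rw [Real.rpow_sub_one hz.ne'] at h
    exact h.congr_deriv (by ring)
  have hnu : nu γ z ^ 2 = (γ - 1) * (z ^ (γ - 1) / f γ z) := by
    unfold nu f
    rw [Real.sq_sqrt]
    exact mul_nonneg (by linarith) (by positivity)
  have hz' : deriv (fun z => H γ L x z) z = x ^ 4 * (2 * z) * (L ^ 2 / f γ z ^ 2 - 1 + 1 / x) +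
      x ^ 4 * z ^ 2 * (-(L ^ 2 * (2 * f γ z * ((γ - 1) * z ^ (γ - 1) / z))) /
        (f γ z ^ 2) ^ 2) := by
    have h1 : HasDerivAt (fun z => L ^ 2 / f γ z ^ 2 - 1 + 1 / x)
        (-(L ^ 2 * (2 * f γ z * ((γ - 1) * z ^ (γ - 1) / z))) / (f γ z ^ 2) ^ 2) z := by
      have h := (((hasDerivAt_const z (L ^ 2)).div (hfd.pow 2)
        (pow_ne_zero 2 hf.ne')).sub_const 1).add_const (1 / x)
      exact h.congr_deriv (by simp)
    have h2 := (((hasDerivAt_pow 2 z).const_mul (x ^ 4)).mul h1)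
    exact (h2.congr_deriv (by simp)).deriv
  have hx' : deriv (fun x => H γ L x z) x =
      4 * x ^ 3 * z ^ 2 * (L ^ 2 / f γ z ^ 2 - 1 + 1 / x) + x ^ 4 * z ^ 2 * (-(x ^ 2)⁻¹) := by
    have h1 : HasDerivAt (fun x => L ^ 2 / f γ z ^ 2 - 1 + 1 / x) (-(x ^ 2)⁻¹) x := by
      have h := (hasDerivAt_inv hx.ne').const_add (L ^ 2 / f γ z ^ 2 - 1)
      simpa [one_div] using h
    have h2 := (((hasDerivAt_pow 4 x).mul_const (z ^ 2)).mul h1)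
    exact (h2.congr_deriv (by simp)).deriv
  unfold flowField hamField
  rw [hz', hx']
  ext
  · simp only [uSq, hnu, Prod.smul_mk, smul_eq_mul]
    field_simp
    ring
  · simp only [uSq, Prod.smul_mk, smul_eq_mul]
    field_simp
    ring

end Michel

/-!
The Hamiltonian `H_L` is conserved, so the stable and unstable manifolds of the critical point lie
on the critical level set, and this level set can be described by calculus in one variable.

For fixed `x > 1` the function `H_L(x, ·)` increases from `0` up to a crest (the point of `c₂` over
`x`) and then decreases to negative values (`exists_crest`). Along the curve `c₁` the Hamiltonian
becomes an explicit function of `z`, which has a strict global minimum at the critical point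
(`IsSonicPoint.H_lt_of_mem_c1`). Hence over each `x > 1` the critical level set consists of exactly
two points `a < b`, one on each side of the crest, which coincide only for `x = x_c`
(`IsSonicPoint.exists_onBranch`). Since `dx/dl` has the sign of `-∂H_L/∂z`, the unstable manifold
must consist of `a` on the left and `b` on the right of `x_c`, and the stable manifold of the other
two halves; these are the two branches `OnBranch` with index `σ = 1` and `σ = -1`. Over `x ≤ 1` the
Hamiltonian increases in `z`, so only the first branch reaches the horizon.

Away from the critical point a branch is differentiable by the implicit function theorem. At the
critical point the second derivative test along straight lines shows on which side of the level set
a line of given slope lies, and traps the branch between lines of nearby slopes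
(`OnBranch.hasDerivAt`).

That orbits converging to the critical point stay on their branch is a scalar monotonicity argument
(`not_tendsto_of_moving_away`). Conversely, on a branch the flow is a scalar equation for `x` whose
right-hand side is differentiable at the rest point `x_c`, so that its solutions take infinite time
to get there (`exists_solution_tendsto_rest_point`). The two parameters `l` and `l̃` are exchanged by
time reversal and a positive change of time, under which stable manifolds are invariant
(`stableManifold_neg`, `stableManifold_eq_of_smul`).
-/

namespace Michel

/-! ### Scalar autonomous equations -/

theorem exists_upper_bound_of_tendsto {G : ℝ → ℝ} (hG : Continuous G) {a b : ℝ}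
    (ha : Tendsto G atTop (𝓝 a)) (hb : Tendsto G atBot (𝓝 b)) : ∃ C, ∀ v, G v ≤ C := by
  obtain ⟨N, hN⟩ := eventually_atTop.1 (ha.eventually_lt_const (lt_add_one a))
  obtain ⟨M, hM⟩ := eventually_atBot.1 (hb.eventually_lt_const (lt_add_one b))
  obtain ⟨C, hC⟩ := (isCompact_Icc (a := M) (b := N)).bddAbove_image hG.continuousOn
  refine ⟨max C (max (a + 1) (b + 1)), fun v => ?_⟩
  rcases le_total v M with h | h
  · exact (hM v h).le.trans (by simp)
  rcases le_total N v with h' | h'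
  · exact (hN v h').le.trans (by simp)
  · exact (hC ⟨v, ⟨h, h'⟩, rfl⟩).trans (by simp)

/-- The equation `θ' = G θ` is solved by inverting the travel time `∫ 1 / G`; since `1 / G` is
bounded below, the travel time takes every real value, so the solution is global. -/
theorem exists_global_solution {G : ℝ → ℝ} (hG : Continuous G) (hpos : ∀ v, 0 < G v) {C : ℝ}
    (hC : ∀ v, G v ≤ C) (v₀ : ℝ) :
    ∃ θ : ℝ → ℝ, θ 0 = v₀ ∧ (∀ t, HasDerivAt θ (G (θ t)) t) ∧ StrictMono θ ∧
      Tendsto θ atTop atTop := by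
  have hcont : Continuous fun v => (G v)⁻¹ := hG.inv₀ fun v => (hpos v).ne'
  set T : ℝ → ℝ := fun v => ∫ y in v₀..v, (G y)⁻¹ with hT
  have hTd : ∀ v, HasDerivAt T (G v)⁻¹ v := fun v =>
    intervalIntegral.integral_hasDerivAt_right (hcont.intervalIntegrable _ _)
      (hcont.stronglyMeasurableAtFilter _ _) hcont.continuousAt
  have hTmono : StrictMono T := strictMono_of_deriv_pos fun v => by
    rw [(hTd v).deriv]; exact inv_pos.2 (hpos v)
  have hTcont : Continuous T := continuous_iff_continuousAt.2 fun v => (hTd v).continuousAt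
  have hC0 : 0 < C := (hpos 0).trans_le (hC 0)
  have hgap : Monotone fun v => T v - v / C := by
    have hd : ∀ v, HasDerivAt (fun v => T v - v / C) ((G v)⁻¹ - 1 / C) v := fun v =>
      (hTd v).sub ((hasDerivAt_id v).div_const C)
    refine monotone_of_deriv_nonneg (fun v => (hd v).differentiableAt) fun v => ?_
    rw [(hd v).deriv, sub_nonneg, one_div]
    exact inv_anti₀ (hpos v) (hC v)
  have htop : Tendsto T atTop atTop := by
    refine tendsto_atTop_mono' atTop (f₁ := fun v => v / C + (T 0 - 0 / C)) ?_
      (tendsto_atTop_add_const_right _ _ (tendsto_id.atTop_div_const hC0))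
    filter_upwards [eventually_ge_atTop 0] with v hv
    have := hgap hv
    simp only at this
    linarith
  have hbot : Tendsto T atBot atBot := by
    refine tendsto_atBot_mono' atBot (f₁ := fun v => v / C + (T 0 - 0 / C)) ?_
      (tendsto_atBot_add_const_right _ _ (tendsto_id.atBot_div_const hC0))
    filter_upwards [eventually_le_atBot 0] with v hv
    have := hgap hv
    simp only at this
    linarith
  let e := hTmono.orderIsoOfSurjective T (hTcont.surjective htop hbot)
  have he : ∀ t, T (e.symm t) = t := fun t => e.apply_symm_apply t
  refine ⟨e.symm, ?_, fun t => ?_, e.symm.strictMono, e.symm.tendsto_atTop⟩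
  · have h0 : e v₀ = 0 := by
      change T v₀ = 0
      simp [hT]
    rw [← h0, e.symm_apply_apply]
  · have h := HasDerivAt.of_local_left_inverse (e.symm.continuous.continuousAt (x := t))
      (hTd (e.symm t)) (inv_ne_zero (hpos _).ne') (Eventually.of_forall he)
    rwa [inv_inv] at h

/-- A scalar equation `X' = F X` with a rest point `c` at which `F` is differentiable: if `F`
points towards `c` on the segment from `c + d` to `c`, the solution starting at `c + d` exists for
all positive times and converges to `c`. In the variable `v = log ((X - c) / d)` the speed is
bounded because of the differentiability of `F` at `c`. -/
theorem exists_solution_tendsto_rest_point {F : ℝ → ℝ} {c d : ℝ} (hF0 : F c = 0)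
    (hF : DifferentiableAt ℝ F c) (hcont : ContinuousOn (fun u => F (c + d * u)) (Ioc 0 1))
    (hneg : ∀ u ∈ Ioc (0 : ℝ) 1, d * F (c + d * u) < 0) :
    ∃ y : ℝ → ℝ, y 0 = 1 ∧ (∀ t ∈ Ici (0 : ℝ), y t ∈ Ioc (0 : ℝ) 1) ∧
      (∀ t, 0 ≤ t → HasDerivAt (fun t => c + d * y t) (F (c + d * y t)) t) ∧
      Tendsto y atTop (𝓝 0) := by
  have hd : d ≠ 0 := by
    rintro rfl
    simpa using hneg 1 (by simp)
  -- the cutoff at `v = 0` makes the speed a function on the whole line without changing it on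
  -- `v ≤ 0`, where the solution stays
  set E : ℝ → ℝ := fun v => Real.exp (min v 0) with hE
  have hEmem : ∀ v, E v ∈ Ioc (0 : ℝ) 1 := fun v =>
    ⟨Real.exp_pos _, Real.exp_le_one_iff.2 (min_le_right _ _)⟩
  have hEcont : Continuous E := by fun_prop
  set G : ℝ → ℝ := fun v => -(F (c + d * E v) / (d * E v)) with hGdef
  have hG : Continuous G := by
    refine ((hcont.comp_continuous hEcont hEmem).div (continuous_const.mul hEcont)
      fun v => mul_ne_zero hd (hEmem v).1.ne').neg
  have hpos : ∀ v, 0 < G v := fun v => by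
    have h1 := hneg _ (hEmem v)
    have h2 := (hEmem v).1
    have : G v = -(d * F (c + d * E v)) / (d ^ 2 * E v) := by
      simp only [hGdef]; field_simp
    rw [this]
    have : 0 < d ^ 2 := by positivity
    exact div_pos (by linarith) (by positivity)
  have hEbot : Tendsto E atBot (𝓝 0) := by
    refine (Real.tendsto_exp_atBot).congr' ?_
    filter_upwards [eventually_le_atBot 0] with v hv
    simp [hE, hv]
  have hGbot : Tendsto G atBot (𝓝 (-deriv F c)) := by
    have h1 : Tendsto (fun v => c + d * E v) atBot (𝓝[≠] c) := by
      refine tendsto_nhdsWithin_iff.2 ⟨?_, Eventually.of_forall fun v => ?_⟩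
      · simpa using (hEbot.const_mul d).const_add c
      · simpa using ⟨hd, (hEmem v).1.ne'⟩
    have h2 := (hasDerivAt_iff_tendsto_slope.1 hF.hasDerivAt).comp h1
    refine (h2.congr fun v => ?_).neg
    simp [slope_def_field, hF0]
  have hGtop : Tendsto G atTop (𝓝 (G 0)) := by
    refine tendsto_const_nhds.congr' ?_
    filter_upwards [eventually_ge_atTop 0] with v hv
    simp [hGdef, hE, hv]
  obtain ⟨C, hC⟩ := exists_upper_bound_of_tendsto hG hGtop hGbot
  -- the solution `θ` runs to `+∞`; its negative is the logarithm of the distance to `c`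
  obtain ⟨θ, hθ0, hθd, hθm, hθt⟩ := exists_global_solution (G := fun v => G (-v))
    (by fun_prop) (fun v => hpos _) (fun v => hC _) 0
  have hle : ∀ t, 0 ≤ t → 0 ≤ θ t := fun t ht => hθ0 ▸ hθm.monotone ht
  refine ⟨fun t => Real.exp (-θ t), by simp [hθ0], fun t ht => ⟨Real.exp_pos _, ?_⟩,
    fun t ht => ?_, ?_⟩
  · simpa using hle t ht
  · have h := (((hθd t).neg.exp).const_mul d).const_add c
    refine h.congr_deriv ?_
    have hmin : E (-θ t) = Real.exp (-θ t) := by simp [hE, hle t ht]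
    simp only [hGdef, hmin, Pi.neg_apply]
    field_simp
  · exact Real.tendsto_exp_neg_atTop_nhds_zero.comp hθt

/-- A quantity with velocity `F`, where `F` vanishes only when the quantity has the value `c`,
cannot tend to `c` if it moves away from `c` at the start: the distance to `c` keeps growing. -/
theorem not_tendsto_of_moving_away {X F : ℝ → ℝ} {c : ℝ}
    (hX : ∀ t ∈ Ici (0 : ℝ), HasDerivWithinAt X (F t) (Ici 0) t) (hF : ContinuousOn F (Ici 0))
    (hne : ∀ t ∈ Ici (0 : ℝ), X t ≠ c → F t ≠ 0) (h0 : 0 < (X 0 - c) * F 0) :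
    ¬ Tendsto X atTop (𝓝 c) := by
  intro hlim
  have hXc : ContinuousOn X (Ici 0) := fun t ht => (hX t ht).continuousWithinAt
  have hDc : ContinuousOn (fun t => (X t - c) * F t) (Ici 0) :=
    (hXc.sub continuousOn_const).mul hF
  have hYmono : ∀ s, 0 ≤ s → (∀ t ∈ Ioo 0 s, 0 < (X t - c) * F t) →
      (X 0 - c) ^ 2 ≤ (X s - c) ^ 2 := by
    intro s hs hpos
    have hsub : Icc 0 s ⊆ Ici (0 : ℝ) := Icc_subset_Ici_self
    refine monotoneOn_of_deriv_nonneg (convex_Icc 0 s)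
      (((hXc.mono hsub).sub continuousOn_const).pow 2) ?_ ?_ (left_mem_Icc.2 hs)
      (right_mem_Icc.2 hs) hs
    · rw [interior_Icc]
      intro t ht
      have h := ((hX t ht.1.le).hasDerivAt (Ici_mem_nhds ht.1)).sub_const c
      exact (h.pow 2).differentiableAt.differentiableWithinAt
    · rw [interior_Icc]
      intro t ht
      have h := ((hX t ht.1.le).hasDerivAt (Ici_mem_nhds ht.1)).sub_const c
      have h2 := (h.pow 2).deriv
      change 0 ≤ deriv (fun t => (X t - c) ^ 2) t
      have h3 : (fun t => (X t - c) ^ 2) = (fun t => X t - c) ^ 2 := rfl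
      rw [h3, h2]
      have := hpos t ht
      simp only [Nat.cast_ofNat, Nat.add_one_sub_one, pow_one]
      nlinarith
  have hne0 : (X 0 - c) ≠ 0 := left_ne_zero_of_mul h0.ne'
  have key : ∀ t ∈ Ici (0 : ℝ), 0 < (X t - c) * F t := by
    by_contra! hcon
    obtain ⟨t, ht, hle⟩ := hcon
    -- the first time at which the outward speed is not positive
    set S := {s | s ∈ Icc 0 t ∧ (X s - c) * F s ≤ 0} with hS
    have hSc : IsClosed S := by
      have := (hDc.mono (Icc_subset_Ici_self : Icc 0 t ⊆ Ici 0)).preimage_isClosed_of_isClosed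
        isClosed_Icc (isClosed_Iic (a := (0 : ℝ)))
      exact this
    have hSne : S.Nonempty := ⟨t, ⟨ht, le_rfl⟩, hle⟩
    have hSb : BddBelow S := ⟨0, fun s hs => hs.1.1⟩
    have hmem := hSc.csInf_mem hSne hSb
    set s := sInf S with hs
    have hbefore : ∀ r ∈ Ico 0 s, 0 < (X r - c) * F r := by
      intro r hr
      by_contra! hcon
      exact (csInf_le hSb (show r ∈ S from ⟨⟨hr.1, hr.2.le.trans hmem.1.2⟩, hcon⟩)).not_gt hr.2
    have hs0 : 0 < s := by
      rcases hmem.1.1.eq_or_lt with h | h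
      · have := hmem.2
        rw [← h] at this
        linarith
      · exact h
    have hzero : (X s - c) * F s = 0 := by
      refine le_antisymm hmem.2 ?_
      have h1 : ContinuousWithinAt (fun t => (X t - c) * F t) (Ioo 0 s) s :=
        (hDc s hmem.1.1).mono fun r hr => hr.1.le
      have : (𝓝[Ioo 0 s] s).NeBot := by
        rw [← mem_closure_iff_nhdsWithin_neBot, closure_Ioo hs0.ne]
        exact ⟨hs0.le, le_rfl⟩
      refine ge_of_tendsto h1 ?_
      filter_upwards [self_mem_nhdsWithin] with r hr
      exact (hbefore r ⟨hr.1.le, hr.2⟩).le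
    have hXs : X s = c := by
      by_contra h
      exact mul_ne_zero (sub_ne_zero.2 h) (hne s hmem.1.1 h) hzero
    have h1 := hYmono s hs0.le fun r hr => hbefore r ⟨hr.1.le, hr.2⟩
    rw [hXs] at h1
    simp only [sub_self, ne_eq, OfNat.ofNat_ne_zero, not_false_eq_true, zero_pow] at h1
    exact hne0 (pow_eq_zero_iff two_ne_zero |>.1 (le_antisymm h1 (sq_nonneg _)))
  have hge : ∀ t ∈ Ici (0 : ℝ), (X 0 - c) ^ 2 ≤ (X t - c) ^ 2 := fun t ht =>
    hYmono t ht fun r hr => key r hr.1.le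
  have hlim2 : Tendsto (fun t => (X t - c) ^ 2) atTop (𝓝 ((c - c) ^ 2)) :=
    (hlim.sub_const c).pow 2
  have h3 := ge_of_tendsto hlim2 (by
    filter_upwards [eventually_ge_atTop 0] with t ht using hge t ht)
  simp only [sub_self, ne_eq, OfNat.ofNat_ne_zero, not_false_eq_true, zero_pow] at h3
  exact hne0 (pow_eq_zero_iff two_ne_zero |>.1 (le_antisymm h3 (sq_nonneg _)))

/-! ### Stable manifolds under time reversal and change of time -/

theorem stableManifold_neg (U : Set (ℝ × ℝ)) (V : ℝ × ℝ → ℝ × ℝ) (p : ℝ × ℝ) :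
    stableManifold U (fun q => -V q) p = unstableManifold U V p := by
  ext q
  constructor
  · rintro ⟨φ, h0, hint, hU, hlim⟩
    refine ⟨fun t => φ (-t), by simpa using h0, fun t ht => ?_, fun t ht => ?_,
      hlim.comp tendsto_neg_atBot_atTop⟩
    · have h := (hint (-t) (by simpa using ht)).scomp t
        ((hasDerivAt_neg t).hasDerivWithinAt (s := Iic 0)) (fun s hs => by simpa using hs)
      simpa [Function.comp_def] using h
    · exact hU _ (by simpa using ht)
  · rintro ⟨φ, h0, hint, hU, hlim⟩
    refine ⟨fun t => φ (-t), by simpa using h0, fun t ht => ?_, fun t ht => ?_,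
      hlim.comp tendsto_neg_atTop_atBot⟩
    · have h := (hint (-t) (by simpa using ht)).scomp t
        ((hasDerivAt_neg t).hasDerivWithinAt (s := Ici 0)) (fun s hs => by simpa using hs)
      simpa [Function.comp_def] using h
    · exact hU _ (by simpa using ht)

theorem stableManifold_subset_of_smul {U : Set (ℝ × ℝ)} {V W : ℝ × ℝ → ℝ × ℝ} {p : ℝ × ℝ}
    {c : ℝ × ℝ → ℝ} (hp : p ∈ U) (hc : ContinuousOn c U) (hpos : ∀ q ∈ U, 0 < c q)
    (hW : ∀ q ∈ U, W q = c q • V q) : stableManifold U V p ⊆ stableManifold U W p := by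
  rintro q ⟨φ, h0, hint, hU, hlim⟩
  have hmax : ∀ v : ℝ, max v 0 ∈ Ici (0 : ℝ) := fun v => mem_Ici.2 (le_max_right _ _)
  -- the cutoff at `v = 0` only serves to have a function on the whole line
  set G : ℝ → ℝ := fun v => c (φ (max v 0)) with hGdef
  have hG : Continuous G :=
    (hc.comp hint.continuousOn hU).comp_continuous (by fun_prop) hmax
  have hGtop : Tendsto G atTop (𝓝 (c p)) := by
    have hφ : Tendsto φ atTop (𝓝[U] p) := tendsto_nhdsWithin_iff.2
      ⟨hlim, by filter_upwards [eventually_ge_atTop 0] with t ht using hU t ht⟩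
    refine ((hc p hp).tendsto.comp hφ).congr' ?_
    filter_upwards [eventually_ge_atTop 0] with v hv
    simp [hGdef, hv]
  have hGbot : Tendsto G atBot (𝓝 (G 0)) := by
    refine tendsto_const_nhds.congr' ?_
    filter_upwards [eventually_le_atBot 0] with v hv
    simp [hGdef, hv]
  obtain ⟨C, hC⟩ := exists_upper_bound_of_tendsto hG hGtop hGbot
  obtain ⟨θ, hθ0, hθd, hθm, hθt⟩ := exists_global_solution hG (fun v => hpos _ (hU _ (hmax v))) hC 0
  have hle : ∀ t ∈ Ici (0 : ℝ), θ t ∈ Ici (0 : ℝ) := fun t ht => by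
    have := hθm.monotone (mem_Ici.1 ht)
    rwa [hθ0] at this
  refine ⟨fun t => φ (θ t), by simp [hθ0, h0], fun t ht => ?_, fun t ht => hU _ (hle t ht),
    hlim.comp hθt⟩
  have h := (hint (θ t) (hle t ht)).scomp t (hθd t).hasDerivWithinAt (fun s hs => hle s hs)
  have hGt : G (θ t) = c (φ (θ t)) := by
    have : max (θ t) 0 = θ t := max_eq_left (hle t ht)
    simp [hGdef, this]
  simp only [hW _ (hU _ (hle t ht)), ← hGt]
  exact h

/-- Multiplying a vector field by a positive function only changes the parameter along the
orbits, and does so without making an orbit reach the limit point in finite time. -/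
theorem stableManifold_eq_of_smul {U : Set (ℝ × ℝ)} {V W : ℝ × ℝ → ℝ × ℝ} {p : ℝ × ℝ}
    {c : ℝ × ℝ → ℝ} (hp : p ∈ U) (hc : ContinuousOn c U) (hpos : ∀ q ∈ U, 0 < c q)
    (hW : ∀ q ∈ U, W q = c q • V q) : stableManifold U V p = stableManifold U W p := by
  refine (stableManifold_subset_of_smul hp hc hpos hW).antisymm
    (stableManifold_subset_of_smul (c := fun q => (c q)⁻¹) hp
      (hc.inv₀ fun q hq => (hpos q hq).ne') (fun q hq => inv_pos.2 (hpos q hq)) fun q hq => ?_)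
  rw [hW q hq, smul_smul, inv_mul_cancel₀ (hpos q hq).ne', one_smul]

/-! ### The equation of state and the derivatives of the Hamiltonian -/

section Calculus

variable {γ L : ℝ}

theorem f_continuous (hγ : 1 < γ) : Continuous (f γ) := by
  unfold f
  exact continuous_const.add (Real.continuous_rpow_const (by linarith))

theorem f_zero (hγ : 1 < γ) : f γ 0 = 1 := by
  simp [f, Real.zero_rpow (show γ - 1 ≠ 0 by linarith)]

theorem one_lt_f {z : ℝ} (hz : 0 < z) : 1 < f γ z := by
  have := Real.rpow_pos_of_pos hz (γ - 1)
  unfold f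
  linarith

theorem one_le_f {z : ℝ} (hz : 0 ≤ z) : 1 ≤ f γ z := by
  have := Real.rpow_nonneg hz (γ - 1)
  unfold f
  linarith

theorem f_strictMonoOn (hγ : 1 < γ) : StrictMonoOn (f γ) (Ici 0) := fun a ha b _ hab => by
  have := Real.rpow_lt_rpow ha hab (show 0 < γ - 1 by linarith)
  unfold f
  linarith

/-- The inverse of the enthalpy as a function of the density. -/
theorem f_rpow_inv (hγ : 1 < γ) {y : ℝ} (hy : 1 < y) : f γ ((y - 1) ^ (γ - 1)⁻¹) = y := by
  unfold f
  rw [Real.rpow_inv_rpow (by linarith) (by linarith)]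
  ring

theorem rpow_inv_f (hγ : 1 < γ) {z : ℝ} (hz : 0 < z) : (f γ z - 1) ^ (γ - 1)⁻¹ = z := by
  unfold f
  rw [add_sub_cancel_left, Real.rpow_rpow_inv hz.le (by linarith)]

theorem exists_f_eq (hγ : 1 < γ) {y : ℝ} (hy : 1 < y) : ∃ z, 0 < z ∧ f γ z = y :=
  ⟨_, Real.rpow_pos_of_pos (by linarith) _, f_rpow_inv hγ hy⟩

theorem hasDerivAt_f {z : ℝ} (hz : 0 < z) :
    HasDerivAt (f γ) ((γ - 1) * (f γ z - 1) / z) z := by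
  have h := (Real.hasDerivAt_rpow_const (x := z) (p := γ - 1) (Or.inl hz.ne')).const_add 1
  rw [Real.rpow_sub_one hz.ne'] at h
  exact h.congr_deriv (by unfold f; ring)

theorem nu_sq (hγ : 1 < γ) {z : ℝ} (hz : 0 < z) :
    nu γ z ^ 2 = (γ - 1) * (f γ z - 1) / f γ z := by
  have := Real.rpow_pos_of_pos hz (γ - 1)
  unfold nu f
  rw [Real.sq_sqrt (mul_nonneg (by linarith) (by positivity))]
  ring

theorem nu_pos (hγ : 1 < γ) {z : ℝ} (hz : 0 < z) : 0 < nu γ z := by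
  have := Real.rpow_pos_of_pos hz (γ - 1)
  unfold nu
  exact Real.sqrt_pos.2 (mul_pos (by linarith) (by positivity))

theorem nu_sq_lt_one (hγ : 1 < γ) (hγ2 : γ ≤ 2) {z : ℝ} (hz : 0 < z) : nu γ z ^ 2 < 1 := by
  have hf := one_lt_f (γ := γ) hz
  rw [nu_sq hγ hz, div_lt_one (by linarith)]
  nlinarith

theorem w_eq (hγ : 1 < γ) {z : ℝ} (hz : 0 < z) : w γ z = (γ - 1) / (2 * f γ z) := by
  have hf := one_lt_f (γ := γ) hz
  have hf0 : f γ z ≠ 0 := by linarith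
  have hnu := nu_pos hγ hz
  have hev : (fun y => nu γ y) =ᶠ[𝓝 z] fun y => Real.sqrt ((γ - 1) * (f γ y - 1) / f γ y) := by
    filter_upwards [lt_mem_nhds hz] with y hy
    rw [← nu_sq hγ hy, Real.sqrt_sq (nu_pos hγ hy).le]
  have hd : HasDerivAt (fun y => (γ - 1) * (f γ y - 1) / f γ y)
      ((γ - 1) ^ 2 * (f γ z - 1) / (z * f γ z ^ 2)) z := by
    refine ((((hasDerivAt_f hz).sub_const 1).const_mul (γ - 1)).div (hasDerivAt_f hz)
      hf0).congr_deriv ?_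
    field_simp
    ring
  have hne : (γ - 1) * (f γ z - 1) / f γ z ≠ 0 := by
    rw [← nu_sq hγ hz]; positivity
  have h := ((hd.sqrt hne).congr_of_eventuallyEq hev).deriv
  rw [← nu_sq hγ hz, Real.sqrt_sq hnu.le] at h
  unfold w
  rw [h]
  have h2 := nu_sq hγ hz
  have h3 : (γ - 1) * (f γ z - 1) = nu γ z ^ 2 * f γ z := by
    rw [h2]; field_simp
  have h4 : (γ - 1) ^ 2 * (f γ z - 1) = (γ - 1) * (nu γ z ^ 2 * f γ z) := by
    rw [← h3]; ring
  rw [h4]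
  field_simp

theorem one_sub_nu_sq_add_w_pos (hγ : 1 < γ) (hγ2 : γ ≤ 2) {z : ℝ} (hz : 0 < z) :
    0 < 1 - nu γ z ^ 2 + w γ z := by
  have h1 := nu_sq_lt_one hγ hγ2 hz
  have hf := one_lt_f (γ := γ) hz
  have h2 : 0 < w γ z := by
    rw [w_eq hγ hz]
    exact div_pos (by linarith) (by linarith)
  linarith

noncomputable section

/-- The coefficient of `x ^ 4` in `H γ L x z`, whose coefficient of `x ^ 3` is `z ^ 2`. -/
def quarticCoeff (γ L z : ℝ) : ℝ := z ^ 2 * (L ^ 2 / f γ z ^ 2 - 1)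

/-- The function `L² (1 - ν²) / f²`, whose comparison with `1 - 1 / x` gives the sign of
`∂H_L/∂z`. -/
def crest (γ L z : ℝ) : ℝ := L ^ 2 / f γ z ^ 2 * (1 - nu γ z ^ 2)

/-- The partial derivative `∂H_L/∂x`. -/
def Hx (γ L x z : ℝ) : ℝ := 4 * x ^ 3 * quarticCoeff γ L z + 3 * x ^ 2 * z ^ 2

/-- The partial derivative `∂H_L/∂z`. -/
def Hz (γ L x z : ℝ) : ℝ := x ^ 4 * (2 * z * (crest γ L z - 1)) + 2 * x ^ 3 * z

end

theorem H_eq {x : ℝ} (hx : x ≠ 0) (z : ℝ) :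
    H γ L x z = x ^ 4 * quarticCoeff γ L z + x ^ 3 * z ^ 2 := by
  unfold H quarticCoeff
  field_simp

theorem Hz_eq {x : ℝ} (hx : x ≠ 0) (z : ℝ) :
    Hz γ L x z = 2 * x ^ 4 * z * (crest γ L z - (1 - 1 / x)) := by
  unfold Hz
  field_simp
  ring

theorem hasDerivAt_quarticCoeff (hγ : 1 < γ) {z : ℝ} (hz : 0 < z) :
    HasDerivAt (quarticCoeff γ L) (2 * z * (crest γ L z - 1)) z := by
  have hf := one_lt_f (γ := γ) hz
  have hf0 : f γ z ≠ 0 := by linarith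
  have h := ((hasDerivAt_pow 2 z).mul (((hasDerivAt_const z (L ^ 2)).div
    ((hasDerivAt_f (γ := γ) hz).pow 2) (pow_ne_zero 2 hf0)).sub_const 1))
  refine h.congr_deriv ?_
  simp only [crest, nu_sq hγ hz, Pi.pow_apply, Pi.div_apply]
  field_simp
  ring

theorem hasDerivAt_crest (hγ : 1 < γ) {z : ℝ} (hz : 0 < z) :
    HasDerivAt (crest γ L)
      (-(2 * nu γ z ^ 2 * (L ^ 2 / f γ z ^ 2) * (1 - nu γ z ^ 2 + w γ z)) / z) z := by
  have hf := one_lt_f (γ := γ) hz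
  have hf0 : f γ z ≠ 0 := by linarith
  have hev : crest γ L =ᶠ[𝓝 z]
      fun y => L ^ 2 / f γ y ^ 2 * (1 - (γ - 1) * (f γ y - 1) / f γ y) := by
    filter_upwards [lt_mem_nhds hz] with y hy
    rw [crest, nu_sq hγ hy]
  have hfd := hasDerivAt_f (γ := γ) hz
  have h := ((hasDerivAt_const z (L ^ 2)).div (hfd.pow 2) (pow_ne_zero 2 hf0)).mul
    ((((hfd.sub_const 1).const_mul (γ - 1)).div hfd hf0).const_sub 1)
  refine (h.congr_of_eventuallyEq hev).congr_deriv ?_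
  simp only [nu_sq hγ hz, w_eq hγ hz, Pi.pow_apply, Pi.div_apply]
  field_simp
  ring

theorem hasDerivAt_quarticCoeff_deriv (hγ : 1 < γ) {z : ℝ} (hz : 0 < z) :
    HasDerivAt (fun z => 2 * z * (crest γ L z - 1)) (2 * (crest γ L z - 1) -
      4 * nu γ z ^ 2 * (L ^ 2 / f γ z ^ 2) * (1 - nu γ z ^ 2 + w γ z)) z := by
  refine (((hasDerivAt_id z).const_mul 2).mul
    ((hasDerivAt_crest (L := L) hγ hz).sub_const 1)).congr_deriv ?_
  simp only [id]
  field_simp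
  ring

theorem hasDerivAt_H_fst {x : ℝ} (hx : x ≠ 0) (z : ℝ) :
    HasDerivAt (fun x => H γ L x z) (Hx γ L x z) x := by
  have hev : (fun x => H γ L x z) =ᶠ[𝓝 x]
      fun x => x ^ 4 * quarticCoeff γ L z + x ^ 3 * z ^ 2 := by
    filter_upwards [isOpen_ne.mem_nhds hx] with y hy using H_eq hy z
  refine ((((hasDerivAt_pow 4 x).mul_const _).add
    ((hasDerivAt_pow 3 x).mul_const _)).congr_of_eventuallyEq hev).congr_deriv ?_
  simp [Hx]

theorem hasDerivAt_H_snd (hγ : 1 < γ) {x z : ℝ} (hx : x ≠ 0) (hz : 0 < z) :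
    HasDerivAt (fun z => H γ L x z) (Hz γ L x z) z := by
  have hev : (fun z => H γ L x z) = fun z => x ^ 4 * quarticCoeff γ L z + x ^ 3 * z ^ 2 :=
    funext fun z => H_eq hx z
  rw [hev]
  refine (((hasDerivAt_quarticCoeff hγ hz).const_mul _).add
    ((hasDerivAt_pow 2 z).const_mul _)).congr_deriv ?_
  simp only [Hz]
  norm_num
  ring

theorem hasStrictFDerivAt_H {x z : ℝ} (hx : x ≠ 0) (hz : 0 < z) :
    ∃ H' : ℝ × ℝ →L[ℝ] ℝ, HasStrictFDerivAt (fun q : ℝ × ℝ => H γ L q.1 q.2) H' (x, z) := by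
  have hf : f γ z ≠ 0 := by linarith [one_lt_f (γ := γ) hz]
  have hC : ContDiffAt ℝ 1 (fun q : ℝ × ℝ => H γ L q.1 q.2) (x, z) := by
    unfold H
    have hfC : ContDiffAt ℝ 1 (fun q : ℝ × ℝ => f γ q.2) (x, z) := by
      unfold f
      exact contDiffAt_const.add (contDiffAt_snd.rpow_const_of_ne hz.ne')
    exact ((contDiffAt_fst.pow 4).mul (contDiffAt_snd.pow 2)).mul
      (((contDiffAt_const.div (hfC.pow 2) (pow_ne_zero 2 hf)).sub contDiffAt_const).add
        (contDiffAt_const.div contDiffAt_fst hx))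
  exact ⟨_, hC.hasStrictFDerivAt (by simp)⟩

/-- The derivative of the Hamiltonian along a curve. -/
theorem hasDerivWithinAt_H_comp (hγ : 1 < γ) {X Z : ℝ → ℝ} {X' Z' t : ℝ} {s : Set ℝ}
    (hX : HasDerivWithinAt X X' s t) (hZ : HasDerivWithinAt Z Z' s t) (hx : X t ≠ 0)
    (hz : 0 < Z t) :
    HasDerivWithinAt (fun t => H γ L (X t) (Z t))
      (Hx γ L (X t) (Z t) * X' + Hz γ L (X t) (Z t) * Z') s t := by
  have hev : (fun t => H γ L (X t) (Z t)) =ᶠ[𝓝[s] t]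
      fun t => X t ^ 4 * quarticCoeff γ L (Z t) + X t ^ 3 * Z t ^ 2 := by
    filter_upwards [hX.continuousWithinAt (isOpen_ne.mem_nhds hx)] with r hr using H_eq hr _
  have hK := (hasDerivAt_quarticCoeff (L := L) hγ hz).comp_hasDerivWithinAt t hZ
  refine ((((hX.pow 4).mul hK).add ((hX.pow 3).mul (hZ.pow 2))).congr_of_eventuallyEq hev
    (H_eq hx _)).congr_deriv ?_
  simp only [Hx, Hz, Pi.pow_apply, Function.comp_apply]
  push_cast
  ring

/-- Away from the zeros of `∂H_L/∂z`, the level sets of `H_L` are locally graphs over `x`. -/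
theorem exists_implicit_level_curve (hγ : 1 < γ) {x z : ℝ} (hx : x ≠ 0) (hz : 0 < z)
    (hne : Hz γ L x z ≠ 0) :
    ∃ g : ℝ → ℝ, g x = z ∧ HasDerivAt g (-(Hx γ L x z / Hz γ L x z)) x ∧
      ∀ᶠ y in 𝓝 x, H γ L y (g y) = H γ L x z := by
  obtain ⟨H', hH'⟩ := hasStrictFDerivAt_H (γ := γ) (L := L) hx hz
  have h1 : H' (0, 1) = Hz γ L x z := by
    have h := hH'.hasFDerivAt.comp_hasDerivAt z
      ((hasDerivAt_const z x).prodMk (hasDerivAt_id z))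
    exact h.unique (hasDerivAt_H_snd hγ hx hz)
  have hinv : (H' ∘L .inr ℝ ℝ ℝ).IsInvertible := by
    refine ⟨ContinuousLinearEquiv.unitsEquivAut ℝ (Units.mk0 _ hne), ?_⟩
    ext
    simp [h1]
  have hg := (hH'.hasStrictFDerivAt_implicitFunctionOfProdDomain hinv).hasFDerivAt
  have hlev := hH'.eventually_apply_implicitFunctionOfProdDomain hinv
  have hgx := (hH'.eventually_apply_eq_iff_implicitFunctionOfProdDomain hinv).self_of_nhds.mp rfl
  set g := hH'.implicitFunctionOfProdDomain hinv
  simp only at hg hlev hgx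
  have hgd : HasDerivAt g (deriv g x) x := hg.differentiableAt.hasDerivAt
  refine ⟨g, hgx, hgd.congr_deriv ?_, hlev⟩
  have hc := hasDerivWithinAt_H_comp (L := L) (s := univ) hγ (hasDerivWithinAt_id x univ)
    hgd.hasDerivWithinAt hx (by rw [hgx]; exact hz)
  have hc' := (hasDerivWithinAt_univ.1 hc).unique
    ((hasDerivAt_const x (H γ L x z)).congr_of_eventuallyEq hlev)
  simp only [id, hgx] at hc'
  field_simp
  linarith

theorem hamField_eq (hγ : 1 < γ) {q : ℝ × ℝ} (hq : q ∈ phaseSpace) :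
    hamField γ L q = (Hz γ L q.1 q.2, -Hx γ L q.1 q.2) := by
  rw [hamField, (hasDerivAt_H_snd hγ hq.1.ne' hq.2).deriv, (hasDerivAt_H_fst hq.1.ne' _).deriv]

theorem isCritical_iff (hγ : 1 < γ) {x z : ℝ} :
    IsCritical γ L (x, z) ↔ (0 < x ∧ 0 < z) ∧ Hx γ L x z = 0 ∧ Hz γ L x z = 0 := by
  refine and_congr_right fun (hq : 0 < x ∧ 0 < z) => ?_
  rw [(hasDerivAt_H_snd hγ hq.1.ne' hq.2).deriv, (hasDerivAt_H_fst hq.1.ne' _).deriv]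

theorem hessDet_eq (hγ : 1 < γ) {x z : ℝ} (hx : 0 < x) (hz : 0 < z) :
    hessDet γ L (x, z) =
      (12 * x ^ 2 * quarticCoeff γ L z + 6 * x * z ^ 2) *
        (x ^ 4 * (2 * (crest γ L z - 1) - 4 * nu γ z ^ 2 * (L ^ 2 / f γ z ^ 2) *
          (1 - nu γ z ^ 2 + w γ z)) + 2 * x ^ 3) -
      (4 * x ^ 3 * (2 * z * (crest γ L z - 1)) + 6 * x ^ 2 * z) ^ 2 := by
  have hxx : HasDerivAt (fun x => deriv (fun x' => H γ L x' z) x)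
      (12 * x ^ 2 * quarticCoeff γ L z + 6 * x * z ^ 2) x := by
    have hev : (fun x => deriv (fun x' => H γ L x' z) x) =ᶠ[𝓝 x] fun x => Hx γ L x z := by
      filter_upwards [lt_mem_nhds hx] with y hy using (hasDerivAt_H_fst hy.ne' z).deriv
    refine HasDerivAt.congr_of_eventuallyEq ?_ hev
    refine ((((hasDerivAt_pow 3 x).const_mul 4).mul_const _).add
      (((hasDerivAt_pow 2 x).const_mul 3).mul_const _)).congr_deriv ?_
    norm_num
    ring
  have hzz : HasDerivAt (fun z => deriv (fun z' => H γ L x z') z)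
      (x ^ 4 * (2 * (crest γ L z - 1) - 4 * nu γ z ^ 2 * (L ^ 2 / f γ z ^ 2) *
          (1 - nu γ z ^ 2 + w γ z)) + 2 * x ^ 3) z := by
    have hev : (fun z => deriv (fun z' => H γ L x z') z) =ᶠ[𝓝 z] fun z => Hz γ L x z := by
      filter_upwards [lt_mem_nhds hz] with y hy using (hasDerivAt_H_snd hγ hx.ne' hy).deriv
    refine HasDerivAt.congr_of_eventuallyEq ?_ hev
    refine (((hasDerivAt_quarticCoeff_deriv hγ hz).const_mul _).add
      ((hasDerivAt_id z).const_mul _)).congr_deriv ?_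
    ring
  have hxz : HasDerivAt (fun x => deriv (fun z => H γ L x z) z)
      (4 * x ^ 3 * (2 * z * (crest γ L z - 1)) + 6 * x ^ 2 * z) x := by
    have hev : (fun x => deriv (fun z => H γ L x z) z) =ᶠ[𝓝 x] fun x => Hz γ L x z := by
      filter_upwards [lt_mem_nhds hx] with y hy using (hasDerivAt_H_snd hγ hy.ne' hz).deriv
    refine HasDerivAt.congr_of_eventuallyEq ?_ hev
    refine (((hasDerivAt_pow 4 x).mul_const _).add
      (((hasDerivAt_pow 3 x).const_mul 2).mul_const _)).congr_deriv ?_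
    push_cast
    ring
  have hzx : HasDerivAt (fun z => deriv (fun x => H γ L x z) x)
      (4 * x ^ 3 * (2 * z * (crest γ L z - 1)) + 6 * x ^ 2 * z) z := by
    have hev : (fun z => deriv (fun x => H γ L x z) x) = fun z => Hx γ L x z :=
      funext fun z => (hasDerivAt_H_fst hx.ne' z).deriv
    rw [hev]
    refine (((hasDerivAt_quarticCoeff hγ hz).const_mul _).add
      ((hasDerivAt_pow 2 z).const_mul _)).congr_deriv ?_
    norm_num
    ring
  simp only [hessDet]
  rw [hxx.deriv, hzz.deriv, hxz.deriv, hzx.deriv]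
  ring

theorem crest_strictAntiOn (hγ : 1 < γ) (hγ2 : γ ≤ 2) (hL : L ≠ 0) :
    StrictAntiOn (crest γ L) (Ioi 0) := by
  refine strictAntiOn_of_deriv_neg (convex_Ioi 0)
    (fun z hz => (hasDerivAt_crest hγ hz).continuousAt.continuousWithinAt) fun z hz => ?_
  rw [interior_Ioi] at hz
  have hz0 : 0 < z := hz
  have hf : 0 < f γ z := by linarith [one_lt_f (γ := γ) hz0]
  have hD := one_sub_nu_sq_add_w_pos hγ hγ2 hz0
  have hnu := nu_pos hγ hz0
  rw [(hasDerivAt_crest hγ hz0).deriv, neg_div, neg_lt_zero]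
  positivity

theorem crest_le (γ L z : ℝ) : crest γ L z ≤ L ^ 2 / f γ z ^ 2 := by
  have h1 : 0 ≤ L ^ 2 / f γ z ^ 2 := by positivity
  have h2 := sq_nonneg (nu γ z)
  unfold crest
  nlinarith

theorem crest_pos (hγ : 1 < γ) (hγ2 : γ ≤ 2) (hL : L ≠ 0) {z : ℝ} (hz : 0 < z) :
    0 < crest γ L z := by
  have hf : 0 < f γ z := by linarith [one_lt_f (γ := γ) hz]
  have := nu_sq_lt_one hγ hγ2 hz
  unfold crest
  have h2 : 0 < 1 - nu γ z ^ 2 := by linarith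
  positivity

theorem exists_crest_eq (hγ : 1 < γ) (hL : 1 < L) {c : ℝ} (hc : 0 < c)
    (hc1 : c < 1) : ∃ z, 0 < z ∧ crest γ L z = c := by
  -- near `z = 0` the function is close to `L² > 1`, and it is at most `L² / f²`
  set g : ℝ → ℝ := fun z => L ^ 2 / f γ z ^ 2 * (1 - (γ - 1) * (f γ z - 1) / f γ z) with hg
  have hgc : ContinuousOn g (Ici 0) := by
    intro z hz
    have hf : f γ z ≠ 0 := by linarith [one_le_f (γ := γ) hz]
    have hfc := (f_continuous hγ).continuousAt (x := z)
    exact ((continuousAt_const.div (hfc.pow 2) (pow_ne_zero 2 hf)).mul (continuousAt_const.sub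
      ((continuousAt_const.mul (hfc.sub continuousAt_const)).div hfc hf))).continuousWithinAt
  have hgz : ∀ z, 0 < z → g z = crest γ L z := fun z hz => by rw [hg, crest, nu_sq hγ hz]
  obtain ⟨Z, hZ, hfZ⟩ := exists_f_eq (γ := γ) hγ (y := L / c) (by
    rw [lt_div_iff₀ hc]; linarith)
  have hgZ : g Z ≤ c := by
    rw [hgz Z hZ]
    refine (crest_le γ L Z).trans ?_
    rw [hfZ, div_pow, div_div_eq_mul_div, mul_comm, mul_div_assoc, div_self (by positivity)]
    nlinarith
  have hg0 : c < g 0 := by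
    simp only [hg, f_zero hγ]
    nlinarith
  obtain ⟨z, hz, hgzc⟩ := intermediate_value_Icc' hZ.le (hgc.mono Icc_subset_Ici_self)
    (show c ∈ Icc (g Z) (g 0) from ⟨hgZ, hg0.le⟩)
  have hz0 : 0 < z := by
    rcases hz.1.eq_or_lt with h | h
    · rw [← h] at hgzc
      exact absurd hgzc hg0.ne'
    · exact h
  exact ⟨z, hz0, by rw [← hgz z hz0, hgzc]⟩

end Calculus

/-! ### The critical point -/

/-- The enthalpy `c = f(z_c)` of the critical point, with `a = γ - 1`, is the only root in `y > 1`
of the cubic `y³ - L² ((1 + 3 a) y - 3 a)`, which is convex there and negative at `y = 1`. The lower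
bound on `c`, which turns the critical point into a saddle, is where `2 / 3 < a` is needed. -/
theorem exists_cubic_root {a L : ℝ} (ha : 2 / 3 < a) (hL : 1 < L) :
    ∃ c : ℝ, 1 < c ∧ c ^ 3 = L ^ 2 * ((1 + 3 * a) * c - 3 * a) ∧ 9 * a < 2 * (1 + 3 * a) * c ∧
      (∀ y, 1 < y → y < c → y ^ 3 < L ^ 2 * ((1 + 3 * a) * y - 3 * a)) ∧
      ∀ y, c < y → L ^ 2 * ((1 + 3 * a) * y - 3 * a) < y ^ 3 := by
  set B := L ^ 2 * (1 + 3 * a) with hB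
  have hL2 : 1 < L ^ 2 := by nlinarith
  have hB1 : 1 < B := by nlinarith
  set q : ℝ → ℝ := fun y => y ^ 3 - (B * y - 3 * a * L ^ 2) with hq
  have hqc : Continuous q := by fun_prop
  have hq1 : q 1 < 0 := by simp only [hq, hB]; nlinarith
  have hqB : 0 < q B := by
    simp only [hq]
    have : B ^ 2 ≤ B ^ 3 := by nlinarith [sq_nonneg B]
    nlinarith
  obtain ⟨c, hc, hqc0⟩ := intermediate_value_Icc hB1.le hqc.continuousOn
    (show (0 : ℝ) ∈ Icc (q 1) (q B) from ⟨hq1.le, hqB.le⟩)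
  have hc1 : 1 < c := by
    rcases hc.1.eq_or_lt with h | h
    · rw [← h] at hqc0; linarith
    · exact h
  have hfac : ∀ y, q y = (y - c) * (y ^ 2 + y * c + c ^ 2 - B) := fun y => by
    have : q y = q y - q c := by rw [hqc0, sub_zero]
    rw [this]; simp only [hq]; ring
  have hkey : B < 1 + c + c ^ 2 := by
    have h1 := hfac 1
    by_contra! hcon
    have : 0 ≤ (1 - c) * (1 ^ 2 + 1 * c + c ^ 2 - B) :=
      mul_nonneg_of_nonpos_of_nonpos (by linarith) (by linarith)
    linarith
  have hpos : ∀ y, 1 < y → 0 < y ^ 2 + y * c + c ^ 2 - B := fun y hy => by nlinarith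
  have hroot : c ^ 3 = L ^ 2 * ((1 + 3 * a) * c - 3 * a) := by
    simp only [hq, hB] at hqc0; linarith
  refine ⟨c, hc1, hroot, ?_, fun y hy hyc => ?_, fun y hy => ?_⟩
  · -- eliminating `L²` from `hkey` leaves `3 a < c² + c`
    have h1 : 0 < (1 + 3 * a) * c - 3 * a := by nlinarith
    have h2 : c ^ 3 * (1 + 3 * a) < (1 + c + c ^ 2) * ((1 + 3 * a) * c - 3 * a) := by
      have : c ^ 3 * (1 + 3 * a) = B * ((1 + 3 * a) * c - 3 * a) := by rw [hroot, hB]; ring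
      rw [this]
      exact mul_lt_mul_of_pos_right hkey h1
    have h3 : 3 * a < c ^ 2 + c := by nlinarith
    by_contra! hcon
    have h5 : 0 < 1 + 3 * a := by linarith
    have h4 : c ≤ 9 * a / (2 * (1 + 3 * a)) := by
      rw [le_div_iff₀ (by positivity)]; linarith
    have h6 : c ^ 2 + c ≤ (9 * a / (2 * (1 + 3 * a))) ^ 2 + 9 * a / (2 * (1 + 3 * a)) := by
      gcongr
    have h7 : (9 * a / (2 * (1 + 3 * a))) ^ 2 + 9 * a / (2 * (1 + 3 * a)) ≤ 3 * a := by
      rw [div_pow, div_add_div _ _ (by positivity) (by positivity), div_le_iff₀ (by positivity)]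
      have : 0 ≤ (1 + 3 * a) * a * (36 * a ^ 2 - 21 * a - 2) := by
        have : 0 ≤ 36 * a ^ 2 - 21 * a - 2 := by nlinarith
        positivity
      nlinarith
    linarith
  · have h := hfac y
    have : (y - c) * (y ^ 2 + y * c + c ^ 2 - B) < 0 :=
      mul_neg_of_neg_of_pos (by linarith) (hpos y hy)
    simp only [hq, hB] at h this
    linarith
  · have h := hfac y
    have : 0 < (y - c) * (y ^ 2 + y * c + c ^ 2 - B) :=
      mul_pos (by linarith) (hpos y (by linarith))
    simp only [hq, hB] at h this
    linarith

/-- The data of the critical point `(x, z)`: the equations for `z` and `x` that characterise it,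
the lower bound on the sound speed that makes it a saddle, and the signs of
`f² - L² (1 + 3 ν²)` on both sides of `z`. -/
structure IsSonicPoint (γ L x z : ℝ) : Prop where
  pos : 0 < z
  enthalpy : f γ z ^ 2 = L ^ 2 * (1 + 3 * nu γ z ^ 2)
  radius : 4 * nu γ z ^ 2 * x = 1 + 3 * nu γ z ^ 2
  sound_speed : 3 * (γ - 1) - 2 < 9 * nu γ z ^ 2
  below : ∀ y, 0 < y → y < z → f γ y ^ 2 < L ^ 2 * (1 + 3 * nu γ y ^ 2)
  above : ∀ y, z < y → L ^ 2 * (1 + 3 * nu γ y ^ 2) < f γ y ^ 2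

section

variable {γ L : ℝ}

theorem exists_isSonicPoint (hγ : 5 / 3 < γ) (hL : 1 < L) : ∃ x z, IsSonicPoint γ L x z := by
  have hγ1 : 1 < γ := by linarith
  obtain ⟨c, hc1, hc, hc2, hlt, hgt⟩ :=
    exists_cubic_root (a := γ - 1) (by linarith) hL
  obtain ⟨z, hz, hfz⟩ := exists_f_eq hγ1 hc1
  have hcub : ∀ y, 0 < y → L ^ 2 * (1 + 3 * nu γ y ^ 2) =
      L ^ 2 * ((1 + 3 * (γ - 1)) * f γ y - 3 * (γ - 1)) / f γ y := fun y hy => by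
    have : f γ y ≠ 0 := by linarith [one_lt_f (γ := γ) hy]
    rw [nu_sq hγ1 hy]
    field_simp
    ring
  have hnu := nu_pos hγ1 hz
  refine ⟨(1 + 3 * nu γ z ^ 2) / (4 * nu γ z ^ 2), z, hz, ?_, by field_simp, ?_,
    fun y hy hyz => ?_, fun y hzy => ?_⟩
  · rw [hcub z hz, hfz, eq_div_iff (by linarith), ← hc]; ring
  · rw [nu_sq hγ1 hz, hfz, mul_div_assoc', lt_div_iff₀ (by linarith)]
    nlinarith
  · have hf := one_lt_f (γ := γ) hy
    rw [hcub y hy, lt_div_iff₀ (by linarith)]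
    have h := hlt (f γ y) hf (hfz ▸ f_strictMonoOn hγ1 hy.le hz.le hyz)
    nlinarith
  · have hy : 0 < y := hz.trans hzy
    have hf := one_lt_f (γ := γ) hy
    rw [hcub y hy, div_lt_iff₀ (by linarith)]
    have h := hgt (f γ y) (hfz ▸ f_strictMonoOn hγ1 hz.le hy.le hzy)
    nlinarith

namespace IsSonicPoint

variable {xc zc : ℝ}

theorem L_sq_div (h : IsSonicPoint γ L xc zc) :
    L ^ 2 / f γ zc ^ 2 = 1 / (1 + 3 * nu γ zc ^ 2) := by
  have hf : 0 < f γ zc := by linarith [one_lt_f (γ := γ) h.pos]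
  have : 0 < 1 + 3 * nu γ zc ^ 2 := by positivity
  rw [div_eq_div_iff (by positivity) (by positivity), h.enthalpy]
  ring

theorem x_eq (h : IsSonicPoint γ L xc zc) (hγ : 1 < γ) :
    xc = (1 + 3 * nu γ zc ^ 2) / (4 * nu γ zc ^ 2) := by
  have := nu_pos hγ h.pos
  rw [eq_div_iff (by positivity), ← h.radius]
  ring

theorem one_lt_x (h : IsSonicPoint γ L xc zc) (hγ : 1 < γ) (hγ2 : γ ≤ 2) : 1 < xc := by
  have := nu_pos hγ h.pos
  have := nu_sq_lt_one hγ hγ2 h.pos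
  rw [h.x_eq hγ, lt_div_iff₀ (by positivity)]
  linarith

theorem quarticCoeff_eq (h : IsSonicPoint γ L xc zc) (hγ : 1 < γ) :
    quarticCoeff γ L zc = -(3 * zc ^ 2) / (4 * xc) := by
  have := nu_pos hγ h.pos
  have h3 : 1 + 3 * nu γ zc ^ 2 ≠ 0 := by positivity
  rw [quarticCoeff, h.L_sq_div, h.x_eq hγ]
  field_simp
  ring

theorem crest_eq (h : IsSonicPoint γ L xc zc) (hγ : 1 < γ) :
    crest γ L zc - 1 = -1 / xc := by
  have := nu_pos hγ h.pos
  have h3 : 1 + 3 * nu γ zc ^ 2 ≠ 0 := by positivity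
  rw [crest, h.L_sq_div, h.x_eq hγ]
  field_simp
  ring

theorem nu_sq_mul (h : IsSonicPoint γ L xc zc) (hγ : 1 < γ) :
    4 * nu γ zc ^ 2 * (L ^ 2 / f γ zc ^ 2) = 1 / xc := by
  have := nu_pos hγ h.pos
  have h3 : 1 + 3 * nu γ zc ^ 2 ≠ 0 := by positivity
  rw [h.L_sq_div, h.x_eq hγ]
  field_simp

theorem Hx_eq_zero (h : IsSonicPoint γ L xc zc) (hγ : 1 < γ) (hγ2 : γ ≤ 2) :
    Hx γ L xc zc = 0 := by
  have := h.one_lt_x hγ hγ2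
  rw [Hx, h.quarticCoeff_eq hγ]
  field_simp
  ring

theorem Hz_eq_zero (h : IsSonicPoint γ L xc zc) (hγ : 1 < γ) (hγ2 : γ ≤ 2) :
    Hz γ L xc zc = 0 := by
  have := h.one_lt_x hγ hγ2
  rw [Hz, h.crest_eq hγ]
  field_simp
  ring

theorem H_eq_value (h : IsSonicPoint γ L xc zc) (hγ : 1 < γ) (hγ2 : γ ≤ 2) :
    H γ L xc zc = xc ^ 3 * zc ^ 2 / 4 := by
  have := h.one_lt_x hγ hγ2
  rw [H_eq (by positivity), h.quarticCoeff_eq hγ]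
  field_simp
  ring

theorem H_pos (h : IsSonicPoint γ L xc zc) (hγ : 1 < γ) (hγ2 : γ ≤ 2) : 0 < H γ L xc zc := by
  have := h.one_lt_x hγ hγ2
  have := h.pos
  rw [h.H_eq_value hγ hγ2]
  positivity

/-- The discriminant of the quadratic equation for the slopes at the critical point. -/
theorem discr_pos (h : IsSonicPoint γ L xc zc) (hγ : 1 < γ) :
    0 < 1 + 3 * nu γ zc ^ 2 - 3 * w γ zc := by
  have hf := one_lt_f (γ := γ) h.pos
  have h1 := h.sound_speed
  have h2 : 2 * w γ zc = γ - 1 - nu γ zc ^ 2 := by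
    rw [w_eq hγ h.pos, nu_sq hγ h.pos]
    field_simp
    ring
  linarith

theorem hessDet_neg (h : IsSonicPoint γ L xc zc) (hγ : 1 < γ) (hγ2 : γ ≤ 2) :
    hessDet γ L (xc, zc) < 0 := by
  have hx := h.one_lt_x hγ hγ2
  have hz := h.pos
  have hd := h.discr_pos hγ
  have : hessDet γ L (xc, zc) = -(xc ^ 4 * zc ^ 2 * (1 + 3 * nu γ zc ^ 2 - 3 * w γ zc)) := by
    rw [hessDet_eq hγ (by linarith) hz, h.quarticCoeff_eq hγ, h.crest_eq hγ, h.nu_sq_mul hγ]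
    field_simp
    ring
  rw [this, neg_lt_zero]
  positivity

theorem isSaddle (h : IsSonicPoint γ L xc zc) (hγ : 1 < γ) (hγ2 : γ ≤ 2) :
    IsSaddle γ L (xc, zc) :=
  ⟨(isCritical_iff hγ).2 ⟨⟨by linarith [h.one_lt_x hγ hγ2], h.pos⟩, h.Hx_eq_zero hγ hγ2,
    h.Hz_eq_zero hγ hγ2⟩, h.hessDet_neg hγ hγ2⟩

theorem eq_of_enthalpy (h : IsSonicPoint γ L xc zc) {z : ℝ} (hz : 0 < z)
    (he : f γ z ^ 2 = L ^ 2 * (1 + 3 * nu γ z ^ 2)) : z = zc := by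
  rcases lt_trichotomy z zc with hlt | heq | hgt
  · exact absurd he (h.below z hz hlt).ne
  · exact heq
  · exact absurd he (h.above z hgt).ne'

theorem eq_of_isCritical (h : IsSonicPoint γ L xc zc) (hγ : 1 < γ) {q : ℝ × ℝ}
    (hq : IsCritical γ L q) : q = (xc, zc) := by
  obtain ⟨x, z⟩ := q
  obtain ⟨⟨hx, hz⟩, h1, h2⟩ := (isCritical_iff hγ).1 hq
  have hf := one_lt_f (γ := γ) hz
  have hnu := nu_pos hγ hz
  have e1 : 4 * x * (L ^ 2 / f γ z ^ 2 - 1) + 3 = 0 := by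
    have : x ^ 2 * z ^ 2 * (4 * x * (L ^ 2 / f γ z ^ 2 - 1) + 3) = 0 := by
      rw [← h1, Hx, quarticCoeff]; ring
    exact (mul_eq_zero.1 this).resolve_left (by positivity)
  have e2 : x * (L ^ 2 / f γ z ^ 2 * (1 - nu γ z ^ 2) - 1) + 1 = 0 := by
    have : 2 * x ^ 3 * z * (x * (L ^ 2 / f γ z ^ 2 * (1 - nu γ z ^ 2) - 1) + 1) = 0 := by
      rw [← h2, Hz, crest]; ring
    exact (mul_eq_zero.1 this).resolve_left (by positivity)
  set g := L ^ 2 / f γ z ^ 2 with hg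
  have e3 : g * (1 + 3 * nu γ z ^ 2) = 1 := by
    have : x * (g * (1 + 3 * nu γ z ^ 2) - 1) = 0 := by linear_combination e1 - 3 * e2
    linarith [(mul_eq_zero.1 this).resolve_left hx.ne']
  have hzc : z = zc := h.eq_of_enthalpy hz (by
    rw [hg, div_mul_eq_mul_div, div_eq_one_iff_eq (by positivity)] at e3
    exact e3.symm)
  have e4 : 4 * nu γ z ^ 2 * x = 1 + 3 * nu γ z ^ 2 := by
    linear_combination (-(1 + 3 * nu γ z ^ 2) / 3) * e1 + (4 * x / 3) * e3
  subst hzc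
  rw [h.x_eq hγ, ← e4]
  congr 1
  field_simp

end IsSonicPoint

end

section

variable {γ L xc zc : ℝ}

/-! ### The Hamiltonian on the curve `c₁` -/

theorem exists_mem_c1 (hγ : 1 < γ) (hL : 1 < L) {x : ℝ} (hx : 3 / 4 < x) :
    ∃ z, (x, z) ∈ c1 γ L := by
  have hx0 : 0 < x := by linarith
  have h1 : 0 < 1 - 3 / (4 * x) := by
    rw [sub_pos, div_lt_one (by positivity)]; linarith
  have h2 : Real.sqrt (1 - 3 / (4 * x)) < 1 := by
    rw [Real.sqrt_lt' one_pos]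
    have : 0 < 3 / (4 * x) := by positivity
    linarith
  have h3 := Real.sqrt_pos.2 h1
  have h4 : L < L / Real.sqrt (1 - 3 / (4 * x)) := by
    rw [lt_div_iff₀ h3]; nlinarith
  obtain ⟨z, hz, hfz⟩ := exists_f_eq hγ (hL.trans h4)
  refine ⟨z, hz, hfz ▸ h4, ?_⟩
  simp only
  rw [hfz, div_pow, Real.sq_sqrt h1.le, div_div_eq_mul_div, mul_div_cancel_left₀]
  · field_simp
    ring
  · exact pow_ne_zero 2 (by linarith)

theorem one_sub_pos_of_lt_f (hL : 0 < L) {z : ℝ} (hf : L < f γ z) : 0 < 1 - L ^ 2 / f γ z ^ 2 := by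
  have hf0 : 0 < f γ z := hL.trans hf
  rw [sub_pos, div_lt_one (by positivity)]
  gcongr

theorem H_of_mem_c1 (hL : 0 < L) {x z : ℝ} (h : (x, z) ∈ c1 γ L) :
    H γ L x z = 27 / 256 * (z ^ 2 / (1 - L ^ 2 / f γ z ^ 2) ^ 3) := by
  obtain ⟨hz, hf, hx⟩ := h
  simp only at hz hf hx
  have h1 := one_sub_pos_of_lt_f hL hf
  have hx0 : 0 < x := by rw [hx]; positivity
  rw [H, hx]
  set g := L ^ 2 / f γ z ^ 2
  have : g - 1 + 1 / (3 / 4 * (1 - g)⁻¹) = (1 - g) / 3 := by field_simp; ring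
  rw [this]
  field_simp
  norm_num

theorem hasDerivAt_H_along_c1 (hγ : 1 < γ) (hL : 0 < L) {z : ℝ} (hz : 0 < z) (hf : L < f γ z) :
    HasDerivAt (fun z => z ^ 2 / (1 - L ^ 2 / f γ z ^ 2) ^ 3)
      (2 * z / (1 - L ^ 2 / f γ z ^ 2) ^ 4 / f γ z ^ 2 *
        (f γ z ^ 2 - L ^ 2 * (1 + 3 * nu γ z ^ 2))) z := by
  have h1 := one_sub_pos_of_lt_f hL hf
  have hf0 : f γ z ≠ 0 := by linarith
  have h := (hasDerivAt_pow 2 z).div ((((hasDerivAt_const z (L ^ 2)).div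
    ((hasDerivAt_f (γ := γ) hz).pow 2) (pow_ne_zero 2 hf0)).const_sub 1).pow 3)
    (pow_ne_zero 3 h1.ne')
  refine h.congr_deriv ?_
  simp only [nu_sq hγ hz, Pi.pow_apply, Pi.div_apply]
  obtain ⟨g, hg⟩ : ∃ g, g = 1 - L ^ 2 / f γ z ^ 2 := ⟨_, rfl⟩
  have hL2 : L ^ 2 = (1 - g) * f γ z ^ 2 := by rw [hg]; field_simp; ring
  rw [← hg] at h1 ⊢
  rw [hL2]
  field_simp
  push_cast
  ring

namespace IsSonicPoint

theorem L_lt_f (h : IsSonicPoint γ L xc zc) (hγ : 1 < γ) (hL : 0 < L) : L < f γ zc := by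
  have hf := one_lt_f (γ := γ) h.pos
  have hnu := nu_pos hγ h.pos
  have := h.enthalpy
  refine lt_of_pow_lt_pow_left₀ 2 (by linarith) ?_
  have : 0 < L ^ 2 * nu γ zc ^ 2 := by positivity
  linarith

theorem mem_c1 (h : IsSonicPoint γ L xc zc) (hγ : 1 < γ) (hL : 0 < L) : (xc, zc) ∈ c1 γ L := by
  refine ⟨h.pos, h.L_lt_f hγ hL, ?_⟩
  have hnu := nu_pos hγ h.pos
  have h3 : 1 + 3 * nu γ zc ^ 2 ≠ 0 := by positivity
  simp only
  rw [h.L_sq_div, h.x_eq hγ]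
  have : 1 - 1 / (1 + 3 * nu γ zc ^ 2) = 3 * nu γ zc ^ 2 / (1 + 3 * nu γ zc ^ 2) := by
    field_simp
    ring
  rw [this]
  field_simp

/-- Along `c₁` the Hamiltonian has a strict global minimum at the critical point. -/
theorem H_lt_of_mem_c1 (h : IsSonicPoint γ L xc zc) (hγ : 1 < γ) (hL : 1 < L) {x z : ℝ}
    (hc : (x, z) ∈ c1 γ L) (hx : x ≠ xc) : H γ L xc zc < H γ L x z := by
  have hL0 : 0 < L := by linarith
  have hcc := h.mem_c1 hγ hL0
  rw [H_of_mem_c1 hL0 hc, H_of_mem_c1 hL0 hcc]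
  have hzz : z ≠ zc := by
    rintro rfl
    exact hx (hc.2.2.trans hcc.2.2.symm)
  obtain ⟨hz, hf, -⟩ := hc
  simp only at hz hf
  have hfm := (f_strictMonoOn hγ).monotoneOn
  set R : ℝ → ℝ := fun z => z ^ 2 / (1 - L ^ 2 / f γ z ^ 2) ^ 3
  have hd : ∀ {y}, 0 < y → L < f γ y → HasDerivAt R _ y := fun hy hfy =>
    hasDerivAt_H_along_c1 hγ hL0 hy hfy
  refine mul_lt_mul_of_pos_left (?_ : R zc < R z) (by norm_num)
  rcases hzz.lt_or_gt with hlt | hgt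
  · have hfy : ∀ {y}, z ≤ y → 0 < y ∧ L < f γ y := fun hy =>
      ⟨hz.trans_le hy, hf.trans_le (hfm hz.le (hz.le.trans hy) hy)⟩
    refine strictAntiOn_of_deriv_neg (convex_Icc z zc) (fun y hy =>
      (hd (hfy hy.1).1 (hfy hy.1).2).continuousAt.continuousWithinAt) (fun y hy => ?_)
      (left_mem_Icc.2 hlt.le) (right_mem_Icc.2 hlt.le) hlt
    rw [interior_Icc] at hy
    obtain ⟨hy0, hfy0⟩ := hfy hy.1.le
    have h1 := one_sub_pos_of_lt_f hL0 hfy0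
    have h2 : 0 < f γ y := by linarith
    rw [(hd hy0 hfy0).deriv]
    exact mul_neg_of_pos_of_neg (by positivity) (sub_neg.2 (h.below y hy0 hy.2))
  · have hfy : ∀ {y}, zc ≤ y → 0 < y ∧ L < f γ y := fun hy =>
      ⟨h.pos.trans_le hy, (h.L_lt_f hγ hL0).trans_le (hfm h.pos.le (h.pos.le.trans hy) hy)⟩
    refine strictMonoOn_of_deriv_pos (convex_Icc zc z) (fun y hy =>
      (hd (hfy hy.1).1 (hfy hy.1).2).continuousAt.continuousWithinAt) (fun y hy => ?_)
      (left_mem_Icc.2 hgt.le) (right_mem_Icc.2 hgt.le) hgt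
    rw [interior_Icc] at hy
    obtain ⟨hy0, hfy0⟩ := hfy hy.1.le
    have h1 := one_sub_pos_of_lt_f hL0 hfy0
    have h2 : 0 < f γ y := by linarith
    rw [(hd hy0 hfy0).deriv]
    exact mul_pos (by positivity) (sub_pos.2 (h.above y hy.1))

/-- Over every `x > 3 / 4` there is a point at which `H_L` exceeds its critical value, strictly if
`x ≠ x_c`. -/
theorem exists_H_ge (h : IsSonicPoint γ L xc zc) (hγ : 1 < γ) (hL : 1 < L) {x : ℝ}
    (hx : 3 / 4 < x) :
    ∃ z, 0 < z ∧ H γ L xc zc ≤ H γ L x z ∧ (x ≠ xc → H γ L xc zc < H γ L x z) := by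
  by_cases hxc : x = xc
  · exact ⟨zc, h.pos, by rw [hxc], fun hne => absurd hxc hne⟩
  · obtain ⟨z, hz⟩ := exists_mem_c1 hγ hL hx
    have := h.H_lt_of_mem_c1 hγ hL hz hxc
    exact ⟨z, hz.1, this.le, fun _ => this⟩

end IsSonicPoint

/-! ### The critical level set -/

theorem H_snd_zero (x : ℝ) : H γ L x 0 = 0 := by simp [H]

theorem continuousOn_H_snd (hγ : 1 < γ) (x : ℝ) : ContinuousOn (fun z => H γ L x z) (Ici 0) := by
  intro z hz
  have hf : f γ z ≠ 0 := by linarith [one_le_f (γ := γ) hz]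
  have hfc := (f_continuous hγ).continuousAt (x := z)
  unfold H
  exact ((continuousAt_const.mul (continuousAt_id.pow 2)).mul
    (((continuousAt_const.div (hfc.pow 2) (pow_ne_zero 2 hf)).sub continuousAt_const).add
      continuousAt_const)).continuousWithinAt

theorem Hz_pos_iff {x z : ℝ} (hx : 0 < x) (hz : 0 < z) :
    0 < Hz γ L x z ↔ 1 - 1 / x < crest γ L z := by
  rw [Hz_eq hx.ne', mul_pos_iff_of_pos_left (by positivity), sub_pos]

theorem Hz_neg_iff {x z : ℝ} (hx : 0 < x) (hz : 0 < z) :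
    Hz γ L x z < 0 ↔ crest γ L z < 1 - 1 / x := by
  rw [Hz_eq hx.ne', ← neg_pos, ← mul_neg, mul_pos_iff_of_pos_left (by positivity), neg_pos, sub_neg]

theorem Hz_pos_of_le_one (hγ : 1 < γ) (hγ2 : γ ≤ 2) (hL : 0 < L) {x z : ℝ} (hx : 0 < x)
    (hx1 : x ≤ 1) (hz : 0 < z) : 0 < Hz γ L x z := by
  rw [Hz_pos_iff hx hz]
  have h1 := crest_pos hγ hγ2 hL.ne' hz
  have h2 : 1 ≤ 1 / x := by rwa [le_div_iff₀ hx, one_mul]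
  linarith

theorem H_strictMonoOn (hγ : 1 < γ) {x : ℝ} (hx : 0 < x) {s : Set ℝ} (hs : Convex ℝ s)
    (hs0 : s ⊆ Ici 0) (hpos : ∀ z ∈ interior s, 0 < Hz γ L x z) :
    StrictMonoOn (fun z => H γ L x z) s := by
  refine strictMonoOn_of_deriv_pos hs ((continuousOn_H_snd hγ x).mono hs0) fun z hz => ?_
  have hz0 : 0 < z := by simpa using interior_mono hs0 hz
  rw [(hasDerivAt_H_snd hγ hx.ne' hz0).deriv]
  exact hpos z hz

theorem H_strictAntiOn (hγ : 1 < γ) {x : ℝ} (hx : 0 < x) {s : Set ℝ} (hs : Convex ℝ s)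
    (hs0 : s ⊆ Ici 0) (hneg : ∀ z ∈ interior s, Hz γ L x z < 0) :
    StrictAntiOn (fun z => H γ L x z) s := by
  refine strictAntiOn_of_deriv_neg hs ((continuousOn_H_snd hγ x).mono hs0) fun z hz => ?_
  have hz0 : 0 < z := by simpa using interior_mono hs0 hz
  rw [(hasDerivAt_H_snd hγ hx.ne' hz0).deriv]
  exact hneg z hz

/-- For `x > 1` the function `H_L(x, ·)` increases up to a crest and decreases afterwards. -/
theorem exists_crest (hγ : 1 < γ) (hγ2 : γ ≤ 2) (hL : 1 < L) {x : ℝ} (hx : 1 < x) :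
    ∃ m, 0 < m ∧ crest γ L m = 1 - 1 / x ∧ StrictMonoOn (fun z => H γ L x z) (Icc 0 m) ∧
      StrictAntiOn (fun z => H γ L x z) (Ici m) := by
  have hx0 : 0 < x := by linarith
  obtain ⟨m, hm, hmc⟩ := exists_crest_eq hγ hL (c := 1 - 1 / x)
    (by rw [sub_pos, div_lt_one hx0]; exact hx) (by simpa using hx0)
  have hanti := crest_strictAntiOn hγ hγ2 (show L ≠ 0 by linarith)
  refine ⟨m, hm, hmc, H_strictMonoOn hγ hx0 (convex_Icc 0 m) Icc_subset_Ici_self fun z hz => ?_,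
    H_strictAntiOn hγ hx0 (convex_Ici m) (Ici_subset_Ici.2 hm.le) fun z hz => ?_⟩
  · rw [interior_Icc] at hz
    rw [Hz_pos_iff hx0 hz.1, ← hmc]
    exact hanti hz.1 hm hz.2
  · rw [interior_Ici] at hz
    have hz0 : 0 < z := hm.trans hz
    rw [Hz_neg_iff hx0 hz0, ← hmc]
    exact hanti hm hz0 hz

namespace IsSonicPoint

/-- For `x > 1` the superlevel set of the critical value in the line over `x` is an interval. -/
theorem exists_level_points (h : IsSonicPoint γ L xc zc) (hγ : 1 < γ) (hγ2 : γ ≤ 2) (hL : 1 < L)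
    {x : ℝ} (hx : 1 < x) :
    ∃ a b m, 0 < a ∧ a ≤ m ∧ m ≤ b ∧ H γ L x a = H γ L xc zc ∧ H γ L x b = H γ L xc zc ∧
      crest γ L m = 1 - 1 / x ∧ StrictMonoOn (fun z => H γ L x z) (Icc 0 m) ∧
      StrictAntiOn (fun z => H γ L x z) (Ici m) ∧ (x ≠ xc → H γ L xc zc < H γ L x m) := by
  have hx0 : 0 < x := by linarith
  obtain ⟨m, hm, hmc, hmono, hantiH⟩ := exists_crest hγ hγ2 hL hx
  obtain ⟨z₁, hz₁, hle, hlt⟩ := h.exists_H_ge hγ hL (x := x) (by linarith)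
  have hHm : H γ L x z₁ ≤ H γ L x m := by
    rcases le_total z₁ m with hzm | hzm
    · exact hmono.monotoneOn ⟨hz₁.le, hzm⟩ ⟨hm.le, le_rfl⟩ hzm
    · exact hantiH.antitoneOn (mem_Ici.2 le_rfl) hzm hzm
  have hHc := h.H_pos hγ hγ2
  have hcont := continuousOn_H_snd (L := L) hγ x
  obtain ⟨a, ha, hHa⟩ := intermediate_value_Icc hm.le (hcont.mono Icc_subset_Ici_self)
    (show H γ L xc zc ∈ Icc (H γ L x 0) (H γ L x m) from
      ⟨by rw [H_snd_zero]; exact hHc.le, hle.trans hHm⟩)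
  have ha0 : 0 < a := by
    rcases ha.1.eq_or_lt with h0 | h0
    · rw [← h0] at hHa
      simp only [H_snd_zero] at hHa
      linarith
    · exact h0
  -- a point so high that the Hamiltonian is negative there
  have hc0 : 0 < 1 - 1 / x := by rw [sub_pos, div_lt_one hx0]; exact hx
  have hc1 : 1 - 1 / x < 1 := by simpa using hx0
  obtain ⟨Z, hZ, hfZ⟩ := exists_f_eq hγ (y := L / (1 - 1 / x)) (by
    rw [lt_div_iff₀ hc0]; linarith)
  have hLf : L ^ 2 / f γ Z ^ 2 < 1 - 1 / x := by
    have hL0 : L ≠ 0 := by linarith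
    rw [hfZ, div_pow, div_div_eq_mul_div, mul_comm, mul_div_assoc, div_self (by positivity)]
    nlinarith
  have hmZ : m ≤ Z := by
    by_contra! hcon
    have h1 := crest_strictAntiOn hγ hγ2 (show L ≠ 0 by linarith) hZ hm hcon
    have h2 := crest_le γ L Z
    linarith
  have hHZ : H γ L x Z < 0 := by
    unfold H
    exact mul_neg_of_pos_of_neg (by positivity) (by linarith)
  obtain ⟨b, hb, hHb⟩ := intermediate_value_Icc' hmZ
    (hcont.mono (Icc_subset_Ici_self.trans (Ici_subset_Ici.2 hm.le)))
    (show H γ L xc zc ∈ Icc (H γ L x Z) (H γ L x m) from ⟨by linarith, hle.trans hHm⟩)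
  exact ⟨a, b, m, ha0, ha.2, hb.1, hHa, hHb, hmc, hmono, hantiH,
    fun hne => (hlt hne).trans_le hHm⟩

/-- On the critical level set, `∂H_L/∂z` vanishes at the critical point only. -/
theorem eq_of_Hz_eq_zero (h : IsSonicPoint γ L xc zc) (hγ : 1 < γ) (hγ2 : γ ≤ 2) (hL : 1 < L)
    {x z : ℝ} (hx : 0 < x) (hz : 0 < z) (hH : H γ L x z = H γ L xc zc)
    (hHz : Hz γ L x z = 0) : x = xc ∧ z = zc := by
  have hinj := (crest_strictAntiOn hγ hγ2 (show L ≠ 0 by linarith)).injOn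
  have hcr : ∀ {y u}, 0 < y → 0 < u → Hz γ L y u = 0 → crest γ L u = 1 - 1 / y := by
    intro y u hy hu hyu
    rw [Hz_eq hy.ne'] at hyu
    linarith [(mul_eq_zero.1 hyu).resolve_left (by positivity)]
  have hx1 : 1 < x := by
    by_contra! hle
    exact (Hz_pos_of_le_one hγ hγ2 (by linarith) hx hle hz).ne' hHz
  obtain ⟨a, b, m, ha, ham, hmb, -, -, hmc, -, -, hlt⟩ := h.exists_level_points hγ hγ2 hL hx1
  have hzm : z = m := hinj hz (ha.trans_le ham) ((hcr hx hz hHz).trans hmc.symm)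
  have hxc : x = xc := by
    by_contra hne
    have := hlt hne
    rw [← hzm, hH] at this
    exact lt_irrefl _ this
  refine ⟨hxc, hinj hz h.pos ?_⟩
  rw [hcr hx hz hHz, hxc,
    hcr (by linarith [h.one_lt_x hγ hγ2]) h.pos (h.Hz_eq_zero hγ hγ2)]

theorem eq_of_H_eq (h : IsSonicPoint γ L xc zc) (hγ : 1 < γ) (hγ2 : γ ≤ 2) (hL : 1 < L)
    {z : ℝ} (hz : 0 < z) (hH : H γ L xc z = H γ L xc zc) : z = zc := by
  have hx1 := h.one_lt_x hγ hγ2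
  obtain ⟨m, hm, hmc, hmono, hanti⟩ := exists_crest hγ hγ2 hL hx1
  have hzm : zc = m := by
    refine (crest_strictAntiOn hγ hγ2 (show L ≠ 0 by linarith)).injOn h.pos hm ?_
    rw [hmc]
    linarith [h.crest_eq hγ, show -1 / xc = -(1 / xc) by ring]
  subst hzm
  rcases le_total z zc with hle | hle
  · exact hmono.injOn ⟨hz.le, hle⟩ ⟨h.pos.le, le_rfl⟩ hH
  · exact hanti.injOn hle (mem_Ici.2 le_rfl) hH

end IsSonicPoint

end

/-! ### The two branches of the critical level set -/

/-- The point `(x, z)` lies on the branch with index `σ = ±1` of the critical level set: it is the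
critical point `(xc, zc)`, or the flow of `σ` times the Hamiltonian vector field moves it towards
the line `x = xc`. -/
def OnBranch (γ L xc zc σ x z : ℝ) : Prop :=
  0 < z ∧ H γ L x z = H γ L xc zc ∧ ((x = xc ∧ z = zc) ∨ σ * (x - xc) * Hz γ L x z < 0)

section

variable {γ L xc zc σ : ℝ}

/-- Over `x > 1` the branches are formed by the end points `a ≤ b` of the interval on which
`H_L(x, ·)` is at least the critical value: one branch takes `a` on the left of the critical point
and `b` on its right, the other one the opposite. -/
theorem IsSonicPoint.exists_onBranch (h : IsSonicPoint γ L xc zc) (hγ : 1 < γ) (hγ2 : γ ≤ 2)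
    (hL : 1 < L) {x : ℝ} (hx : 1 < x) :
    ∃ a b m, 0 < a ∧ a ≤ m ∧ m ≤ b ∧ crest γ L m = 1 - 1 / x ∧
      (∀ y, 0 < y → (H γ L xc zc ≤ H γ L x y ↔ y ∈ Icc a b)) ∧
      (∀ y, 0 < y → H γ L x y ≤ H γ L xc zc → y ≤ a ∨ b ≤ y) ∧
      (∀ σ, σ * (x - xc) < 0 → OnBranch γ L xc zc σ x a) ∧
      (∀ σ, 0 < σ * (x - xc) → OnBranch γ L xc zc σ x b) ∧
      (x = xc → a = zc ∧ b = zc) ∧ (x ≠ xc → a < m ∧ m < b) := by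
  have hx0 : 0 < x := by linarith
  obtain ⟨a, b, m, ha, ham, hmb, hHa, hHb, hmc, hmono, hanti, hlt⟩ :=
    h.exists_level_points hγ hγ2 hL hx
  have hcr := crest_strictAntiOn hγ hγ2 (show L ≠ 0 by linarith)
  have hm : 0 < m := ha.trans_le ham
  have hb : 0 < b := hm.trans_le hmb
  have ham' : x ≠ xc → a < m := fun hne => ham.lt_of_ne fun he => by
    have := hlt hne
    rw [← he, hHa] at this
    exact lt_irrefl _ this
  have hmb' : x ≠ xc → m < b := fun hne => hmb.lt_of_ne fun he => by
    have := hlt hne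
    rw [he, hHb] at this
    exact lt_irrefl _ this
  have hout : ∀ y, 0 < y → y < a → H γ L x y < H γ L xc zc := fun y hy hya => by
    rw [← hHa]
    exact hmono ⟨hy.le, hya.le.trans ham⟩ ⟨ha.le, ham⟩ hya
  have hout' : ∀ y, b < y → H γ L x y < H γ L xc zc := fun y hby => by
    rw [← hHb]
    exact hanti hmb (mem_Ici.2 (hmb.trans hby.le)) hby
  have hin : ∀ y, a < y → y < b → H γ L xc zc < H γ L x y := fun y hay hyb => by
    rcases le_total y m with hym | hym
    · rw [← hHa]
      exact hmono ⟨ha.le, ham⟩ ⟨ha.le.trans hay.le, hym⟩ hay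
    · rw [← hHb]
      exact hanti hym hmb hyb
  refine ⟨a, b, m, ha, ham, hmb, hmc, fun y hy => ⟨fun hle => ⟨?_, ?_⟩, fun hy' => ?_⟩,
    fun y hy hle => ?_, fun σ hσ => ⟨ha, hHa, Or.inr ?_⟩, fun σ hσ => ⟨hb, hHb, Or.inr ?_⟩,
    fun hxc => ?_, fun hne => ⟨ham' hne, hmb' hne⟩⟩
  · by_contra! hcon
    exact (hout y hy hcon).not_ge hle
  · by_contra! hcon
    exact (hout' y hcon).not_ge hle
  · rcases hy'.1.eq_or_lt with he | h1
    · rw [← he, hHa]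
    rcases hy'.2.eq_or_lt with he | h2
    · rw [he, hHb]
    exact (hin y h1 h2).le
  · by_contra! hcon
    exact (hin y hcon.1 hcon.2).not_ge hle
  · have hne : x ≠ xc := by rintro rfl; simp at hσ
    refine mul_neg_of_neg_of_pos hσ ((Hz_pos_iff hx0 ha).2 ?_)
    rw [← hmc]
    exact hcr ha hm (ham' hne)
  · have hne : x ≠ xc := by rintro rfl; simp at hσ
    refine mul_neg_of_pos_of_neg hσ ((Hz_neg_iff hx0 hb).2 ?_)
    rw [← hmc]
    exact hcr hm hb (hmb' hne)
  · subst hxc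
    exact ⟨h.eq_of_H_eq hγ hγ2 hL ha hHa, h.eq_of_H_eq hγ hγ2 hL hb hHb⟩

theorem IsSonicPoint.onBranch_self (h : IsSonicPoint γ L xc zc) : OnBranch γ L xc zc σ xc zc :=
  ⟨h.pos, rfl, Or.inl ⟨rfl, rfl⟩⟩

/-- Two points of the critical level set over the same `x` at which `∂H_L/∂z` has the same sign
coincide. -/
theorem OnBranch.eq (h : IsSonicPoint γ L xc zc) (hγ : 1 < γ) (hγ2 : γ ≤ 2) (hL : 1 < L)
    {x z z' : ℝ} (hx : 0 < x) (hz : OnBranch γ L xc zc σ x z)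
    (hz' : OnBranch γ L xc zc σ x z') : z = z' := by
  obtain ⟨hz0, hH, hs⟩ := hz
  obtain ⟨hz0', hH', hs'⟩ := hz'
  by_cases hxc : x = xc
  · subst hxc
    rw [h.eq_of_H_eq hγ hγ2 hL hz0 hH, h.eq_of_H_eq hγ hγ2 hL hz0' hH']
  have h1 := hs.resolve_left fun hh => hxc hh.1
  have h2 := hs'.resolve_left fun hh => hxc hh.1
  have hcr := crest_strictAntiOn hγ hγ2 (show L ≠ 0 by linarith)
  wlog hle : z ≤ z' generalizing z z'
  · exact (this hz0' hH' hs' hz0 hH hs h2 h1 (le_of_not_ge hle)).symm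
  rcases lt_or_ge (σ * (x - xc)) 0 with hσ | hσ
  · have hpos' : 0 < Hz γ L x z' := by
      by_contra! hcon
      exact h2.not_ge (mul_nonneg_of_nonpos_of_nonpos hσ.le hcon)
    refine (H_strictMonoOn (L := L) hγ hx (convex_Icc 0 z') Icc_subset_Ici_self fun y hy => ?_).injOn
      ⟨hz0.le, hle⟩ ⟨hz0'.le, le_rfl⟩ (hH.trans hH'.symm)
    rw [interior_Icc] at hy
    exact (Hz_pos_iff hx hy.1).2 (((Hz_pos_iff hx hz0').1 hpos').trans (hcr hy.1 hz0' hy.2))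
  · have hneg : Hz γ L x z < 0 := by
      by_contra! hcon
      exact h1.not_ge (mul_nonneg hσ hcon)
    refine (H_strictAntiOn (L := L) hγ hx (convex_Ici z) (Ici_subset_Ici.2 hz0.le) fun y hy => ?_).injOn
      (mem_Ici.2 le_rfl) hle (hH.trans hH'.symm)
    rw [interior_Ici] at hy
    have hy0 : 0 < y := hz0.trans hy
    exact (Hz_neg_iff hx hy0).2 ((hcr hz0 hy0 hy).trans ((Hz_neg_iff hx hz0).1 hneg))

theorem IsSonicPoint.exists_onBranch_of_one_lt (h : IsSonicPoint γ L xc zc) (hγ : 1 < γ)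
    (hγ2 : γ ≤ 2) (hL : 1 < L) (hσ : σ ≠ 0) {x : ℝ} (hx : 1 < x) :
    ∃ z, OnBranch γ L xc zc σ x z := by
  obtain ⟨a, b, m, -, -, -, -, -, -, hA, hB, -⟩ := h.exists_onBranch hγ hγ2 hL hx
  rcases lt_trichotomy (σ * (x - xc)) 0 with hlt | heq | hgt
  · exact ⟨a, hA σ hlt⟩
  · have : x = xc := by linarith [(mul_eq_zero.1 heq).resolve_left hσ]
    exact ⟨zc, this ▸ h.onBranch_self⟩
  · exact ⟨b, hB σ hgt⟩

/-- The branch with index `1` reaches the horizon `x = 1`, where `H_L` is increasing in `z`. -/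
theorem IsSonicPoint.exists_onBranch_horizon (h : IsSonicPoint γ L xc zc) (hγ : 1 < γ)
    (hγ2 : γ ≤ 2) (hL : 1 < L) : ∃ z, OnBranch γ L xc zc 1 1 z := by
  obtain ⟨Z, hZ, hle, -⟩ := h.exists_H_ge hγ hL (x := 1) (by norm_num)
  have hHc := h.H_pos hγ hγ2
  obtain ⟨z, hz, hHz⟩ := intermediate_value_Icc hZ.le
    ((continuousOn_H_snd (L := L) hγ 1).mono Icc_subset_Ici_self)
    (show H γ L xc zc ∈ Icc (H γ L 1 0) (H γ L 1 Z) from ⟨by rw [H_snd_zero]; exact hHc.le, hle⟩)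
  have hz0 : 0 < z := by
    rcases hz.1.eq_or_lt with h0 | h0
    · rw [← h0] at hHz
      simp only [H_snd_zero] at hHz
      linarith
    · exact h0
  refine ⟨z, hz0, hHz, Or.inr (mul_neg_of_neg_of_pos ?_
    (Hz_pos_of_le_one hγ hγ2 (by linarith) one_pos le_rfl hz0))⟩
  linarith [h.one_lt_x hγ hγ2]

theorem OnBranch.one_lt (h : IsSonicPoint γ L xc zc) (hγ : 1 < γ) (hγ2 : γ ≤ 2) (hL : 1 < L)
    {x z : ℝ} (hx : 0 < x) (hb : OnBranch γ L xc zc (-1) x z) : 1 < x := by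
  have hxc := h.one_lt_x hγ hγ2
  by_contra! hle
  have hpos := Hz_pos_of_le_one (L := L) hγ hγ2 (by linarith) hx hle hb.1
  rcases hb.2.2 with he | hlt
  · linarith [he.1]
  · exact hlt.not_ge (mul_nonneg (by linarith) hpos.le)

/-! ### Differentiability of the branches -/

theorem hasDerivAt_of_mem_uIcc {Z : ℝ → ℝ} {c m δ : ℝ} (hδ : 0 < δ)
    (hZ : ∀ ε ∈ Ioo 0 δ, ∀ᶠ x in 𝓝 c,
      Z x ∈ uIcc (Z c + (m - ε) * (x - c)) (Z c + (m + ε) * (x - c))) : HasDerivAt Z m c := by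
  rw [hasDerivAt_iff_isLittleO, Asymptotics.isLittleO_iff]
  intro e he
  filter_upwards [hZ (min e (δ / 2)) ⟨by positivity, (min_le_right _ _).trans_lt (by linarith)⟩]
    with x hx
  have h1 : |Z x - Z c - m * (x - c)| ≤ |min e (δ / 2) * (x - c)| := by
    have h2 := le_abs_self (min e (δ / 2) * (x - c))
    have h3 := neg_abs_le (min e (δ / 2) * (x - c))
    rcases mem_uIcc.1 hx with hx | hx <;> exact abs_le.2 ⟨by linarith, by linarith⟩
  rw [Real.norm_eq_abs, Real.norm_eq_abs, smul_eq_mul, mul_comm (x - c)]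
  refine h1.trans ?_
  rw [abs_mul, abs_of_pos (by positivity : 0 < min e (δ / 2))]
  gcongr
  exact min_le_left _ _

theorem continuousAt_crest (hγ : 1 < γ) {z : ℝ} (hz : 0 < z) : ContinuousAt (crest γ L) z :=
  (hasDerivAt_crest hγ hz).continuousAt

/-- A branch defined on an interval is differentiable away from the critical point. -/
theorem OnBranch.differentiableWithinAt (h : IsSonicPoint γ L xc zc) (hγ : 1 < γ) (hγ2 : γ ≤ 2)
    (hL : 1 < L) {D : Set ℝ} (hD : ∀ x ∈ D, 0 < x) {Z : ℝ → ℝ}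
    (hZ : ∀ x ∈ D, OnBranch γ L xc zc σ x (Z x)) {x : ℝ} (hx : x ∈ D) (hne : x ≠ xc) :
    DifferentiableWithinAt ℝ Z D x := by
  obtain ⟨hz0, hH, hs⟩ := hZ x hx
  have hlt := hs.resolve_left fun hh => hne hh.1
  obtain ⟨g, hgx, hgd, hgH⟩ := exists_implicit_level_curve hγ (hD x hx).ne' hz0
    (right_ne_zero_of_mul hlt.ne)
  have hg0 : ∀ᶠ y in 𝓝 x, 0 < g y := hgd.continuousAt (lt_mem_nhds (by rw [hgx]; exact hz0))
  have hcont : ContinuousAt (fun y => σ * (y - xc) * Hz γ L y (g y)) x := by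
    have hc : ContinuousAt (fun y => crest γ L (g y)) x :=
      ContinuousAt.comp (g := crest γ L) (by rw [hgx]; exact continuousAt_crest hγ hz0)
        hgd.continuousAt
    have := hgd.continuousAt
    unfold Hz
    fun_prop
  have hglt : ∀ᶠ y in 𝓝 x, σ * (y - xc) * Hz γ L y (g y) < 0 :=
    hcont (gt_mem_nhds (by simpa only [hgx] using hlt))
  refine hgd.differentiableAt.differentiableWithinAt.congr_of_eventuallyEq ?_ hgx.symm
  filter_upwards [self_mem_nhdsWithin, nhdsWithin_le_nhds hg0, nhdsWithin_le_nhds hglt,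
    nhdsWithin_le_nhds hgH] with y hyD hy0 hylt hyH
  exact (hZ y hyD).eq h hγ hγ2 hL (hD y hyD) ⟨hy0, hyH.trans hH, Or.inr hylt⟩

/-- The second derivative test along the line of slope `k` through the critical point; the quadratic
polynomial in `k` is, up to the factor `-xc`, the second derivative of `H_L` along this line. -/
theorem IsSonicPoint.line_isLocal (h : IsSonicPoint γ L xc zc) (hγ : 1 < γ) (hγ2 : γ ≤ 2) (k : ℝ) :
    ((1 - nu γ zc ^ 2 + w γ zc) * (xc * k) ^ 2 + 4 * zc * (xc * k) + 3 * zc ^ 2 < 0 →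
      IsLocalMin (fun x => H γ L x (zc + k * (x - xc))) xc) ∧
    (0 < (1 - nu γ zc ^ 2 + w γ zc) * (xc * k) ^ 2 + 4 * zc * (xc * k) + 3 * zc ^ 2 →
      IsLocalMax (fun x => H γ L x (zc + k * (x - xc))) xc) := by
  have hx := h.one_lt_x hγ hγ2
  have hx0 : 0 < xc := by linarith
  set ℓ : ℝ → ℝ := fun x => zc + k * (x - xc) with hℓ
  have hℓc : ℓ xc = zc := by simp [hℓ]
  have hℓd : ∀ x, HasDerivAt ℓ k x := fun x =>
    ((((hasDerivAt_id x).sub_const xc).const_mul k).const_add zc).congr_deriv (mul_one k)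
  have hd : ∀ x, 0 < x → 0 < ℓ x → HasDerivAt (fun x => H γ L x (ℓ x))
      (Hx γ L x (ℓ x) * 1 + Hz γ L x (ℓ x) * k) x := fun x hx hz =>
    hasDerivWithinAt_univ.1 (hasDerivWithinAt_H_comp hγ (hasDerivWithinAt_id x univ)
      (hℓd x).hasDerivWithinAt hx.ne' hz)
  have hev : ∀ᶠ x in 𝓝 xc, deriv (fun x => H γ L x (ℓ x)) x =
      Hx γ L x (ℓ x) * 1 + Hz γ L x (ℓ x) * k := by
    filter_upwards [lt_mem_nhds hx0,
      (hℓd xc).continuousAt (lt_mem_nhds (by rw [hℓc]; exact h.pos))] with x h1 h2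
    exact (hd x h1 h2).deriv
  have hd0 : deriv (fun x => H γ L x (ℓ x)) xc = 0 := by
    rw [hev.self_of_nhds, hℓc, h.Hx_eq_zero hγ hγ2, h.Hz_eq_zero hγ hγ2]
    ring
  have hd2 : deriv (deriv fun x => H γ L x (ℓ x)) xc =
      -(xc * ((1 - nu γ zc ^ 2 + w γ zc) * (xc * k) ^ 2 + 4 * zc * (xc * k) + 3 * zc ^ 2)) := by
    rw [EventuallyEq.deriv_eq hev]
    have hK : HasDerivAt (fun x => quarticCoeff γ L (ℓ x)) (2 * zc * (crest γ L zc - 1) * k) xc :=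
      HasDerivAt.comp (h₂ := quarticCoeff γ L) xc
        (by rw [hℓc]; exact hasDerivAt_quarticCoeff hγ h.pos) (hℓd xc)
    have hK' : HasDerivAt (fun x => 2 * ℓ x * (crest γ L (ℓ x) - 1))
        ((2 * (crest γ L zc - 1) - 4 * nu γ zc ^ 2 * (L ^ 2 / f γ zc ^ 2) *
          (1 - nu γ zc ^ 2 + w γ zc)) * k) xc :=
      HasDerivAt.comp (h₂ := fun z => 2 * z * (crest γ L z - 1)) xc
        (by rw [hℓc]; exact hasDerivAt_quarticCoeff_deriv hγ h.pos) (hℓd xc)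
    have hHx : HasDerivAt (fun x => Hx γ L x (ℓ x)) _ xc :=
      (((hasDerivAt_pow 3 xc).const_mul 4).mul hK).add
        (((hasDerivAt_pow 2 xc).const_mul 3).mul ((hℓd xc).pow 2))
    have hHz : HasDerivAt (fun x => Hz γ L x (ℓ x)) _ xc :=
      ((hasDerivAt_pow 4 xc).mul hK').add
        (((hasDerivAt_pow 3 xc).const_mul 2).mul (hℓd xc))
    refine ((hHx.mul_const 1).add (hHz.mul_const k)).deriv.trans ?_
    simp only [hℓc, h.quarticCoeff_eq hγ, h.crest_eq hγ, h.nu_sq_mul hγ]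
    push_cast
    field_simp
    ring
  have hc : ContinuousAt (fun x => H γ L x (ℓ x)) xc :=
    (hd xc hx0 (by rw [hℓc]; exact h.pos)).continuousAt
  constructor
  · intro hN
    refine isLocalMin_of_deriv_deriv_pos ?_ hd0 hc
    rw [hd2]
    exact neg_pos.2 (mul_neg_of_pos_of_neg hx0 hN)
  · intro hN
    refine isLocalMax_of_deriv_deriv_neg ?_ hd0 hc
    rw [hd2]
    exact neg_neg_iff_pos.2 (mul_pos hx0 hN)

end

section

variable {γ L xc zc σ : ℝ}

/-- The slope of a branch at the critical point. The lines whose slope is slightly smaller and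
slightly larger stay, near the critical point, on different sides of the level set, which traps
the branch between them. -/
theorem OnBranch.hasDerivAt (h : IsSonicPoint γ L xc zc) (hγ : 1 < γ) (hγ2 : γ ≤ 2) (hL : 1 < L)
    (hσ : σ = 1 ∨ σ = -1) {Z : ℝ → ℝ} (hZ : ∀ x, 1 < x → OnBranch γ L xc zc σ x (Z x)) :
    HasDerivAt Z (zc / xc * ((-2 + σ * Real.sqrt (1 + 3 * nu γ zc ^ 2 - 3 * w γ zc)) /
      (1 - nu γ zc ^ 2 + w γ zc))) xc := by
  have hx1 := h.one_lt_x hγ hγ2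
  have hx0 : 0 < xc := by linarith
  have hz0 := h.pos
  have hD := one_sub_nu_sq_add_w_pos hγ hγ2 h.pos
  have hΔ := h.discr_pos hγ
  set D := 1 - nu γ zc ^ 2 + w γ zc with hDdef
  set r := Real.sqrt (1 + 3 * nu γ zc ^ 2 - 3 * w γ zc) with hr
  have hr0 : 0 < r := Real.sqrt_pos.2 hΔ
  have hr2 : r ^ 2 = 4 - 3 * D := by rw [hr, Real.sq_sqrt hΔ.le, hDdef]; ring
  have hσ2 : σ ^ 2 = 1 := by rcases hσ with rfl | rfl <;> norm_num
  set m := zc / xc * ((-2 + σ * r) / D) with hm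
  have hZc : Z xc = zc := (hZ xc hx1).eq h hγ hγ2 hL hx0 h.onBranch_self
  have hN : ∀ τ, D * (xc * (m + τ)) ^ 2 + 4 * zc * (xc * (m + τ)) + 3 * zc ^ 2 =
      xc * τ * (D * xc * τ + 2 * zc * σ * r) := fun τ => by
    have h1 : D * (xc * m) = zc * (-2 + σ * r) := by rw [hm]; field_simp
    have h2 : D * (D * (xc * m) ^ 2 + 4 * zc * (xc * m) + 3 * zc ^ 2) = 0 := by
      linear_combination (D * (xc * m) + zc * (-2 + σ * r) + 4 * zc) * h1 +
        zc ^ 2 * r ^ 2 * hσ2 + zc ^ 2 * hr2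
    have h3 := (mul_eq_zero.1 h2).resolve_left hD.ne'
    linear_combination h3 + 2 * xc * τ * h1
  -- the polynomial is negative for slopes between its two roots, and `δ` is their distance
  refine hasDerivAt_of_mem_uIcc (δ := 2 * zc * r / (D * xc)) (by positivity) fun ε hε => ?_
  have hε2 : D * xc * ε < 2 * zc * r := by
    have := (lt_div_iff₀ (by positivity)).1 hε.2
    linarith
  have hmin := (h.line_isLocal hγ hγ2 (m + -(σ * ε))).1 (by
    rw [← hDdef, hN]
    have : xc * -(σ * ε) * (D * xc * -(σ * ε) + 2 * zc * σ * r) =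
        -(xc * ε * (2 * zc * r - D * xc * ε)) * σ ^ 2 := by ring
    rw [this, hσ2, mul_one, neg_lt_zero]
    exact mul_pos (mul_pos hx0 hε.1) (by linarith))
  have hmax := (h.line_isLocal hγ hγ2 (m + σ * ε)).2 (by
    rw [← hDdef, hN]
    have : xc * (σ * ε) * (D * xc * (σ * ε) + 2 * zc * σ * r) =
        xc * ε * (2 * zc * r + D * xc * ε) * σ ^ 2 := by ring
    rw [this, hσ2, mul_one]
    have := hε.1
    positivity)
  have hposev : ∀ k : ℝ, ∀ᶠ x in 𝓝 xc, 0 < zc + k * (x - xc) := fun k => by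
    have hc : ContinuousAt (fun x => zc + k * (x - xc)) xc := by fun_prop
    exact hc (lt_mem_nhds (by simpa using hz0))
  filter_upwards [hmin, hmax, hposev (m + -(σ * ε)), hposev (m + σ * ε), lt_mem_nhds hx1]
    with x h1 h2 hy1 hy2 hx
  simp only [sub_self, mul_zero, add_zero] at h1 h2
  obtain ⟨a, b, -, -, -, -, -, hin, hout, hA, hB, -⟩ := h.exists_onBranch hγ hγ2 hL hx
  set y₁ := zc + (m + -(σ * ε)) * (x - xc) with hy₁
  set y₂ := zc + (m + σ * ε) * (x - xc) with hy₂
  have hmem := (hin y₁ hy1).1 h1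
  have hdiff : y₂ - y₁ = 2 * ε * (σ * (x - xc)) := by rw [hy₁, hy₂]; ring
  have hkey : Z x ∈ uIcc y₁ y₂ := by
    rw [mem_uIcc]
    have hx0' : 0 < x := by linarith
    rcases lt_trichotomy (σ * (x - xc)) 0 with hlt | heq | hgt
    · have hZa : Z x = a := (hZ x hx).eq h hγ hγ2 hL hx0' (hA σ hlt)
      have hlt' : y₂ < y₁ := by
        have := mul_neg_of_pos_of_neg (mul_pos two_pos hε.1) hlt
        linarith
      rw [hZa]
      refine Or.inr ⟨(hout y₂ hy2 h2).resolve_right fun hcon => ?_, hmem.1⟩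
      linarith [hmem.2]
    · have hσ0 : σ ≠ 0 := by rintro rfl; norm_num at hσ2
      have hxx : x - xc = 0 := (mul_eq_zero.1 heq).resolve_left hσ0
      have hxc : x = xc := by linarith
      left
      rw [hy₁, hy₂, hxx, hxc, hZc]
      simp
    · have hZb : Z x = b := (hZ x hx).eq h hγ hγ2 hL hx0' (hB σ hgt)
      have hlt' : y₁ < y₂ := by
        have := mul_pos (mul_pos two_pos hε.1) hgt
        linarith
      rw [hZb]
      refine Or.inl ⟨hmem.2, (hout y₂ hy2 h2).resolve_left fun hcon => ?_⟩
      linarith [hmem.1]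
  rw [hZc]
  rcases hσ with rfl | rfl
  · simpa [hy₁, hy₂, sub_eq_add_neg] using hkey
  · rw [uIcc_comm]
    simpa [hy₁, hy₂, sub_eq_add_neg] using hkey

/-! ### The dynamics on the critical level set -/

/-- Orbits that converge to the critical point lie on the critical level set, and they cannot
start by moving away from the line `x = xc`. -/
theorem onBranch_of_mem_stableManifold (h : IsSonicPoint γ L xc zc) (hγ : 1 < γ) (hγ2 : γ ≤ 2)
    (hL : 1 < L) (hσ : σ ≠ 0) {V : ℝ × ℝ → ℝ × ℝ}
    (hV : ∀ q ∈ phaseSpace, V q = (σ * Hz γ L q.1 q.2, -(σ * Hx γ L q.1 q.2))) {q : ℝ × ℝ}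
    (hq : q ∈ stableManifold phaseSpace V (xc, zc)) :
    q ∈ phaseSpace ∧ OnBranch γ L xc zc σ q.1 q.2 := by
  obtain ⟨φ, h0, hint, hU, hlim⟩ := hq
  have hx0 : 0 < xc := by linarith [h.one_lt_x hγ hγ2]
  have hqU : q ∈ phaseSpace := h0 ▸ hU 0 (mem_Ici.2 le_rfl)
  have hder : ∀ t ∈ Ici (0 : ℝ), HasDerivWithinAt φ
      (σ * Hz γ L (φ t).1 (φ t).2, -(σ * Hx γ L (φ t).1 (φ t).2)) (Ici 0) t := fun t ht => by
    rw [← hV _ (hU t ht)]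
    exact hint t ht
  have hX : ∀ t ∈ Ici (0 : ℝ), HasDerivWithinAt (fun t => (φ t).1)
      (σ * Hz γ L (φ t).1 (φ t).2) (Ici 0) t := fun t ht => (hder t ht).fst
  have hY : ∀ t ∈ Ici (0 : ℝ), HasDerivWithinAt (fun t => (φ t).2)
      (-(σ * Hx γ L (φ t).1 (φ t).2)) (Ici 0) t := fun t ht => (hder t ht).snd
  have hHd : ∀ t ∈ Ici (0 : ℝ), HasDerivWithinAt (fun t => H γ L (φ t).1 (φ t).2) 0 (Ici 0) t :=
    fun t ht => (hasDerivWithinAt_H_comp hγ (hX t ht) (hY t ht) (hU t ht).1.ne'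
      (hU t ht).2).congr_deriv (by ring)
  have hconst : ∀ t ∈ Ici (0 : ℝ), H γ L (φ t).1 (φ t).2 = H γ L q.1 q.2 := fun t ht => by
    rw [← h0]
    refine (convex_Ici (0 : ℝ)).is_const_of_fderivWithin_eq_zero
      (fun s hs => (hHd s hs).differentiableWithinAt) (fun s hs => ?_) ht (mem_Ici.2 le_rfl)
    rw [(hHd s hs).hasFDerivWithinAt.fderivWithin (uniqueDiffOn_Ici 0 s hs)]
    simp
  have hH : H γ L q.1 q.2 = H γ L xc zc := by
    obtain ⟨H', hH'⟩ := hasStrictFDerivAt_H (γ := γ) (L := L) hx0.ne' h.pos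
    have h1 := hH'.hasFDerivAt.continuousAt.tendsto.comp hlim
    refine tendsto_nhds_unique (tendsto_const_nhds.congr' ?_) h1
    filter_upwards [eventually_ge_atTop 0] with t ht using (hconst t ht).symm
  have hXlim : Tendsto (fun t => (φ t).1) atTop (𝓝 xc) := hlim.fst_nhds
  have hcr : ∀ t ∈ Ici (0 : ℝ), ContinuousWithinAt (fun t => crest γ L (φ t).2) (Ici 0) t :=
    fun t ht => (continuousAt_crest hγ (hU t ht).2).comp_continuousWithinAt
      (f := fun t => (φ t).2) (hY t ht).continuousWithinAt
  have hFc : ContinuousOn (fun t => σ * Hz γ L (φ t).1 (φ t).2) (Ici 0) := by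
    intro t ht
    have h1 := (hX t ht).continuousWithinAt
    have h2 := (hY t ht).continuousWithinAt
    have h3 := hcr t ht
    unfold Hz
    fun_prop
  have hnot := not_tendsto_of_moving_away (c := xc) hX hFc fun t ht hne h00 => hne
    (h.eq_of_Hz_eq_zero hγ hγ2 hL (hU t ht).1 (hU t ht).2 ((hconst t ht).trans hH)
      ((mul_eq_zero.1 h00).resolve_left hσ)).1
  rw [h0] at hnot
  have hle : (q.1 - xc) * (σ * Hz γ L q.1 q.2) ≤ 0 := not_lt.1 fun hcon => hnot hcon hXlim
  refine ⟨hqU, hqU.2, hH, ?_⟩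
  rcases hle.eq_or_lt with heq | hlt
  · left
    rcases mul_eq_zero.1 heq with h1 | h1
    · have hqx : q.1 = xc := by linarith
      rw [hqx] at hH
      exact ⟨hqx, h.eq_of_H_eq hγ hγ2 hL hqU.2 hH⟩
    · exact h.eq_of_Hz_eq_zero hγ hγ2 hL hqU.1 hqU.2 hH ((mul_eq_zero.1 h1).resolve_left hσ)
  · right
    linarith [show σ * (q.1 - xc) * Hz γ L q.1 q.2 = (q.1 - xc) * (σ * Hz γ L q.1 q.2) by ring]

/-- The points of a differentiable branch lie on the stable manifold: the equation for `x` on the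
branch is a scalar equation with the rest point `xc`, and conservation of `H_L` gives the equation
for `z`. -/
theorem mem_stableManifold_of_onBranch (h : IsSonicPoint γ L xc zc) (hγ : 1 < γ) (hγ2 : γ ≤ 2)
    (hL : 1 < L) {V : ℝ × ℝ → ℝ × ℝ}
    (hV : ∀ q ∈ phaseSpace, V q = (σ * Hz γ L q.1 q.2, -(σ * Hx γ L q.1 q.2)))
    {D : Set ℝ} (hDc : Convex ℝ D) (hD : ∀ x ∈ D, 0 < x) (hxcD : xc ∈ D) {Z : ℝ → ℝ}
    (hZ : ∀ x ∈ D, OnBranch γ L xc zc σ x (Z x)) (hZd : DifferentiableOn ℝ Z D)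
    (hZc : DifferentiableAt ℝ Z xc) {x : ℝ} (hx : x ∈ D) :
    (x, Z x) ∈ stableManifold phaseSpace V (xc, zc) := by
  have hx0 := hD xc hxcD
  have hZxc : Z xc = zc := (hZ xc hxcD).eq h hγ hγ2 hL hx0 h.onBranch_self
  by_cases hxxc : x = xc
  · subst hxxc
    rw [hZxc]
    refine ⟨fun _ => (x, zc), rfl, fun t _ => ?_, fun _ _ => ⟨hx0, h.pos⟩, tendsto_const_nhds⟩
    have hV0 : V (x, zc) = 0 := by
      rw [hV _ ⟨hx0, h.pos⟩]
      simp [h.Hz_eq_zero hγ hγ2, h.Hx_eq_zero hγ hγ2]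
    simp only [hV0]
    exact hasDerivWithinAt_const _ _ _
  set d := x - xc with hd
  have hd0 : d ≠ 0 := sub_ne_zero.2 hxxc
  have hseg : ∀ u ∈ Ioc (0 : ℝ) 1, xc + d * u ∈ D := fun u hu => by
    have := hDc.add_smul_sub_mem hxcD hx ⟨hu.1.le, hu.2⟩
    rwa [smul_eq_mul, mul_comm] at this
  have hbr : ∀ y ∈ D, y ≠ xc → σ * (y - xc) * Hz γ L y (Z y) < 0 := fun y hy hne =>
    (hZ y hy).2.2.resolve_left fun hh => hne hh.1
  set F : ℝ → ℝ := fun y => σ * Hz γ L y (Z y) with hF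
  have hFd : DifferentiableAt ℝ F xc := by
    have hcr : DifferentiableAt ℝ (fun y => crest γ L (Z y)) xc :=
      DifferentiableAt.comp (g := crest γ L) xc
        (by rw [hZxc]; exact (hasDerivAt_crest hγ h.pos).differentiableAt) hZc
    simp only [hF, Hz]
    fun_prop
  have hFcont : ContinuousOn F D := by
    have h1 : ContinuousOn (fun y => crest γ L (Z y)) D := fun y hy =>
      (continuousAt_crest hγ (hZ y hy).1).comp_continuousWithinAt (hZd.continuousOn y hy)
    have h2 := hZd.continuousOn
    simp only [hF, Hz]
    fun_prop
  obtain ⟨y, hy0, hymem, hyd, hylim⟩ := exists_solution_tendsto_rest_point (F := F) (c := xc)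
    (d := d) (by simp only [hF, hZxc, h.Hz_eq_zero hγ hγ2, mul_zero]) hFd
    (hFcont.comp (by fun_prop) hseg) fun u hu => by
      have h1 := hbr _ (hseg u hu) (by simpa using ⟨hd0, hu.1.ne'⟩)
      have h2 : σ * (xc + d * u - xc) * Hz γ L (xc + d * u) (Z (xc + d * u)) =
          u * (d * F (xc + d * u)) := by simp only [hF]; ring
      rw [h2] at h1
      exact (pos_iff_neg_of_mul_neg h1).1 hu.1
  set X : ℝ → ℝ := fun t => xc + d * y t with hX
  have hXD : ∀ t ∈ Ici (0 : ℝ), X t ∈ D := fun t ht => hseg _ (hymem t ht)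
  have hXne : ∀ t ∈ Ici (0 : ℝ), X t ≠ xc := fun t ht => by
    simpa [hX] using ⟨hd0, (hymem t ht).1.ne'⟩
  have hXlim : Tendsto X atTop (𝓝 xc) := by
    simpa using (hylim.const_mul d).const_add xc
  refine ⟨fun t => (X t, Z (X t)), ?_, fun t ht => ?_, fun t ht => ⟨hD _ (hXD t ht),
    (hZ _ (hXD t ht)).1⟩, ?_⟩
  · have : X 0 = x := by simp only [hX, hy0, hd]; ring
    simp only [this]
  · have hX' : HasDerivWithinAt X (F (X t)) (Ici 0) t := (hyd t ht).hasDerivWithinAt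
    have hZ' := (hZd _ (hXD t ht)).hasDerivWithinAt.comp t hX' hXD
    set e := derivWithin Z D (X t) * F (X t)
    have hconst : HasDerivWithinAt (fun t => H γ L (X t) (Z (X t))) 0 (Ici 0) t :=
      (hasDerivWithinAt_const t (Ici 0) (H γ L xc zc)).congr
        (fun s hs => (hZ _ (hXD s hs)).2.1) (hZ _ (hXD t ht)).2.1
    have hchain := hasDerivWithinAt_H_comp (L := L) hγ hX' hZ' (hD _ (hXD t ht)).ne'
      (hZ _ (hXD t ht)).1
    have heq := (uniqueDiffOn_Ici (0 : ℝ) t ht).eq_deriv _ hchain hconst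
    have hHz := right_ne_zero_of_mul (hbr _ (hXD t ht) (hXne t ht)).ne
    have he : e = -(σ * Hx γ L (X t) (Z (X t))) := by
      have : Hz γ L (X t) (Z (X t)) * (e + σ * Hx γ L (X t) (Z (X t))) = 0 := by
        simp only [hF, Function.comp_apply] at heq
        linarith
      linarith [(mul_eq_zero.1 this).resolve_left hHz]
    have hfin := hX'.prodMk hZ'
    rw [he] at hfin
    simp only [hV _ (show (X t, Z (X t)) ∈ phaseSpace from ⟨hD _ (hXD t ht), (hZ _ (hXD t ht)).1⟩)]
    exact hfin
  · have := hZc.continuousAt.tendsto.comp hXlim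
    rw [hZxc] at this
    exact hXlim.prodMk_nhds this

/-- The positive factor between the two vector fields. -/
theorem continuousOn_timeFactor (hγ : 1 < γ) :
    ContinuousOn (fun q : ℝ × ℝ => f γ q.2 ^ 2 / (q.1 ^ 4 * q.2 ^ 2)) phaseSpace := by
  have hfc := f_continuous hγ
  intro q hq
  have h1 : q.1 ^ 4 * q.2 ^ 2 ≠ 0 := by
    have := hq.1
    have := hq.2
    positivity
  exact ContinuousAt.continuousWithinAt (by fun_prop (disch := exact h1))

theorem timeFactor_pos {q : ℝ × ℝ} (hq : q ∈ phaseSpace) :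
    0 < f γ q.2 ^ 2 / (q.1 ^ 4 * q.2 ^ 2) := by
  have h1 := hq.1
  have h2 := hq.2
  have h3 := one_lt_f (γ := γ) h2
  have h4 : 0 < f γ q.2 := by linarith
  positivity

theorem GammaPlus_eq (hγ : 1 < γ) {p : ℝ × ℝ} (hp : p ∈ phaseSpace) :
    GammaPlus γ L p = stableManifold phaseSpace (hamField γ L) p := by
  rw [GammaPlus, ← stableManifold_neg]
  refine (stableManifold_eq_of_smul hp (continuousOn_timeFactor hγ)
    (fun q hq => timeFactor_pos hq) fun q hq => ?_).symm
  rw [flowField_eq hγ.le hq, neg_smul, neg_neg]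

theorem GammaMinus_eq (hγ : 1 < γ) {p : ℝ × ℝ} (hp : p ∈ phaseSpace) :
    GammaMinus γ L p = unstableManifold phaseSpace (hamField γ L) p := by
  rw [GammaMinus, ← stableManifold_neg]
  refine (stableManifold_eq_of_smul hp (continuousOn_timeFactor hγ)
    (fun q hq => timeFactor_pos hq) fun q hq => ?_).symm
  rw [flowField_eq hγ.le hq, neg_smul, smul_neg]

end

section

variable {γ L xc zc : ℝ}

/-! ### The position and the limits of the branches -/

theorem crest_eq_of_mem_c2 {x z : ℝ} (h : (x, z) ∈ c2 γ L) : crest γ L z = 1 - 1 / x := by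
  have hx : x = (1 - crest γ L z)⁻¹ := h.2.2
  rw [hx, one_div, inv_inv]
  ring

theorem mem_c2_of_crest_eq (hγ : 1 < γ) (hγ2 : γ ≤ 2) {x z : ℝ} (hx : 0 < x)
    (hz : 0 < z) (h : crest γ L z = 1 - 1 / x) : (x, z) ∈ c2 γ L := by
  have hf : 0 < f γ z := by linarith [one_lt_f (γ := γ) hz]
  have hnu : 0 < 1 - nu γ z ^ 2 := by linarith [nu_sq_lt_one hγ hγ2 hz]
  refine ⟨hz, ?_, ?_⟩
  · refine lt_of_pow_lt_pow_left₀ 2 hf.le ?_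
    simp only [mul_pow]
    rw [Real.sq_sqrt hnu.le]
    have h1 : crest γ L z < 1 := by
      have : 0 < 1 / x := by positivity
      linarith
    rw [crest, div_mul_eq_mul_div, div_lt_one (by positivity)] at h1
    exact h1
  · change x = (1 - crest γ L z)⁻¹
    rw [h, sub_sub_cancel, one_div, inv_inv]

theorem OnBranch.liesAbove_c1 (h : IsSonicPoint γ L xc zc) (hγ : 1 < γ) (hγ2 : γ ≤ 2)
    (hL : 1 < L) {x z : ℝ} (hx : xc < x) (hz : OnBranch γ L xc zc 1 x z) :
    LiesAbove (x, z) (c1 γ L) := by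
  have hx1 := (h.one_lt_x hγ hγ2).trans hx
  obtain ⟨a, b, m, -, -, -, -, hin, -, -, hB, -⟩ := h.exists_onBranch hγ hγ2 hL hx1
  have hzb : z = b := hz.eq h hγ hγ2 hL (by linarith) (hB 1 (by linarith))
  refine ⟨exists_mem_c1 hγ hL (x := x) (by linarith), fun y (hy : (x, y) ∈ c1 γ L) => ?_⟩
  have hlt := h.H_lt_of_mem_c1 hγ hL hy hx.ne'
  have hmem := (hin y hy.1).1 hlt.le
  refine lt_of_le_of_ne (hzb ▸ hmem.2) fun he => ?_
  rw [he, hz.2.1] at hlt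
  exact lt_irrefl _ hlt

theorem OnBranch.liesBelow_c2 (h : IsSonicPoint γ L xc zc) (hγ : 1 < γ) (hγ2 : γ ≤ 2)
    (hL : 1 < L) {x z : ℝ} (hx : xc < x) (hz : OnBranch γ L xc zc (-1) x z) :
    LiesBelow (x, z) (c2 γ L) := by
  have hx1 := (h.one_lt_x hγ hγ2).trans hx
  have hx0 : 0 < x := by linarith
  obtain ⟨a, b, m, ha, ham, -, hmc, -, -, hA, -, -, hne⟩ := h.exists_onBranch hγ hγ2 hL hx1
  have hza : z = a := hz.eq h hγ hγ2 hL hx0 (hA (-1) (by linarith))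
  refine ⟨⟨m, mem_c2_of_crest_eq hγ hγ2 hx0 (ha.trans_le ham) hmc⟩,
    fun y (hy : (x, y) ∈ c2 γ L) => ?_⟩
  have hym : y = m := (crest_strictAntiOn hγ hγ2 (show L ≠ 0 by linarith)).injOn hy.1
    (ha.trans_le ham) ((crest_eq_of_mem_c2 hy).trans hmc.symm)
  rw [hym]
  exact hza ▸ (hne hx.ne').1

/-- Close to the horizon the crest of `H_L(x, ·)`, above which the branch lies, is at arbitrarily
high densities. -/
theorem OnBranch.tendsto_horizon (h : IsSonicPoint γ L xc zc) (hγ : 1 < γ) (hγ2 : γ ≤ 2)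
    (hL : 1 < L) {Z : ℝ → ℝ} (hZ : ∀ x, 1 < x → OnBranch γ L xc zc (-1) x (Z x)) :
    Tendsto Z (𝓝[>] 1) atTop := by
  have hL0 : L ≠ 0 := by linarith
  refine tendsto_atTop.2 fun B => ?_
  set B' := max B 1 with hB'
  have hB0 : 0 < B' := lt_max_of_lt_right one_pos
  have hlim : Tendsto (fun x : ℝ => 1 - 1 / x) (𝓝 1) (𝓝 (1 - 1 / 1)) :=
    tendsto_const_nhds.sub (tendsto_const_nhds.div tendsto_id one_ne_zero)
  have hev := hlim.eventually_lt_const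
    (show 1 - 1 / 1 < crest γ L B' by simpa using crest_pos hγ hγ2 hL0 hB0)
  filter_upwards [self_mem_nhdsWithin, nhdsWithin_le_nhds hev,
    nhdsWithin_le_nhds (gt_mem_nhds (h.one_lt_x hγ hγ2))] with x hx1 hxB hxc
  obtain ⟨a, b, m, ha, ham, hmb, hmc, -, -, -, hB, -⟩ := h.exists_onBranch hγ hγ2 hL hx1
  have hx0 : (0 : ℝ) < x := one_pos.trans hx1
  have hZb : Z x = b := (hZ x hx1).eq h hγ hγ2 hL hx0 (hB (-1) (by linarith))
  have hBm : B' < m := by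
    by_contra! hcon
    have := (crest_strictAntiOn hγ hγ2 hL0).antitoneOn (ha.trans_le ham) hB0 hcon
    linarith
  rw [hZb]
  exact ((le_max_left _ _).trans hBm.le).trans hmb

theorem OnBranch.tendsto_infinity (h : IsSonicPoint γ L xc zc) (hγ : 1 < γ) (hγ2 : γ ≤ 2)
    (hL : 1 < L) {Z : ℝ → ℝ} (hZ : ∀ x, 1 ≤ x → OnBranch γ L xc zc 1 x (Z x)) :
    ∃ zinf, 0 < zinf ∧ f γ zinf = L ∧ Tendsto Z atTop (𝓝 zinf) := by
  have hL0 : 0 < L := by linarith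
  obtain ⟨zinf, hzi, hfzi⟩ := exists_f_eq hγ hL
  refine ⟨zinf, hzi, hfzi, ?_⟩
  have hx1 := h.one_lt_x hγ hγ2
  have hZpos : ∀ x, 1 ≤ x → 0 < Z x := fun x hx => (hZ x hx).1
  have hlow : ∀ x, xc < x → zinf < Z x := fun x hx => by
    obtain ⟨⟨y, hy⟩, hlt⟩ := (hZ x (by linarith)).liesAbove_c1 h hγ hγ2 hL hx
    refine lt_trans ?_ (hlt y hy)
    by_contra! hcon
    have h1 := (f_strictMonoOn hγ).monotoneOn (hy.1.le) hzi.le hcon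
    have h2 : L < f γ y := hy.2.1
    linarith
  -- on the level set, `L² / f²` differs from `1` by terms that tend to zero
  have hr : ∀ x, 1 ≤ x →
      L ^ 2 / f γ (Z x) ^ 2 = 1 - 1 / x + H γ L xc zc / (x ^ 4 * Z x ^ 2) := fun x hx => by
    have hx0 : x ≠ 0 := by linarith
    have hz := (hZpos x hx).ne'
    rw [← (hZ x hx).2.1, H]
    field_simp
    ring
  have hsmall : Tendsto (fun x => H γ L xc zc / (x ^ 4 * Z x ^ 2)) atTop (𝓝 0) := by
    have hbig : Tendsto (fun x : ℝ => x ^ 4 * zinf ^ 2) atTop atTop :=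
      (tendsto_pow_atTop (by norm_num)).atTop_mul_const (by positivity)
    refine squeeze_zero' ?_ ?_ (tendsto_const_nhds (x := H γ L xc zc).div_atTop hbig)
    · filter_upwards [eventually_ge_atTop 1] with x hx
      have := h.H_pos hγ hγ2
      positivity
    · filter_upwards [eventually_gt_atTop xc] with x hx
      have h1 := (hlow x hx).le
      have h2 := h.H_pos hγ hγ2
      have h3 : 0 < x := by linarith
      gcongr
  have hlimr : Tendsto (fun x => L ^ 2 / f γ (Z x) ^ 2) atTop (𝓝 1) := by
    have h1 : Tendsto (fun x : ℝ => 1 - 1 / x + H γ L xc zc / (x ^ 4 * Z x ^ 2)) atTop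
        (𝓝 (1 - 0 + 0)) :=
      (tendsto_const_nhds.sub (tendsto_const_nhds.div_atTop tendsto_id)).add hsmall
    rw [sub_zero, add_zero] at h1
    refine h1.congr' ?_
    filter_upwards [eventually_ge_atTop 1] with x hx using (hr x hx).symm
  have hlimf : Tendsto (fun x => f γ (Z x)) atTop (𝓝 L) := by
    have h1 := (tendsto_const_nhds (x := L)).div hlimr.sqrt (by simp)
    rw [Real.sqrt_one, div_one] at h1
    refine h1.congr' ?_
    filter_upwards [eventually_ge_atTop 1] with x hx
    have hf : 0 < f γ (Z x) := by linarith [one_lt_f (γ := γ) (hZpos x hx)]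
    simp only [Pi.div_apply]
    rw [← div_pow, Real.sqrt_sq (by positivity)]
    field_simp
  have h2 := (hlimf.sub_const 1).rpow_const (p := (γ - 1)⁻¹) (Or.inl (by linarith))
  have h3 : (L - 1) ^ (γ - 1)⁻¹ = zinf := by rw [← hfzi, rpow_inv_f hγ hzi]
  rw [h3] at h2
  refine h2.congr' ?_
  filter_upwards [eventually_ge_atTop 1] with x hx using rpow_inv_f hγ (hZpos x hx)

theorem OnBranch.isGlobalAccretionFlow {Z : ℝ → ℝ} (hH : 0 ≤ H γ L xc zc)
    (hμ : H γ L xc zc ≠ 0) (hZ : ∀ x, 1 ≤ x → OnBranch γ L xc zc 1 x (Z x))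
    (hd : DifferentiableOn ℝ Z (Ici 1)) :
    IsGlobalAccretionFlow γ L (-Real.sqrt (H γ L xc zc)) Z
      fun x => -Real.sqrt (H γ L xc zc) / (x ^ 2 * Z x) := by
  have hpos : ∀ x ∈ Ici (1 : ℝ), 0 < x ^ 2 * Z x := fun x hx => by
    have h1 : 0 < x := one_pos.trans_le hx
    have h2 := (hZ x hx).1
    positivity
  have hs : 0 < Real.sqrt (H γ L xc zc) := Real.sqrt_pos.2 (hH.lt_of_ne' hμ)
  refine ⟨hd, ?_, fun x hx => (hZ x hx).1, fun x hx => ?_, fun x hx => ?_, fun x hx => ?_⟩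
  · exact (differentiableOn_const _).div ((differentiableOn_id.pow 2).mul hd)
      fun x hx => (hpos x hx).ne'
  · exact div_neg_of_neg_of_pos (neg_lt_zero.2 hs) (hpos x hx)
  · exact mul_div_cancel₀ _ (hpos x hx).ne'
  · have hx0 : x ≠ 0 := (one_pos.trans_le hx).ne'
    have hz0 := (hZ x hx).1
    have hf : f γ (Z x) ≠ 0 := by linarith [one_lt_f (γ := γ) hz0]
    simp only [div_pow, neg_sq, Real.sq_sqrt hH]
    rw [← (hZ x hx).2.1, H]
    field_simp
    ring

end

end Michel

/-! ### The stable and unstable manifolds of the critical point -/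

open Michel in
theorem mainTheorem5 (γ L : ℝ) (hγ : 5 / 3 < γ) (hγ2 : γ ≤ 2) (hL : 1 < L) :
    ∃ p : ℝ × ℝ, Michel.IsSaddle γ L p ∧ (∀ q : ℝ × ℝ, Michel.IsCritical γ L q → q = p) ∧
      1 < p.1 ∧
      Michel.GammaPlus γ L p =
        Michel.stableManifold Michel.phaseSpace (Michel.hamField γ L) p ∧
      Michel.GammaMinus γ L p =
        Michel.unstableManifold Michel.phaseSpace (Michel.hamField γ L) p ∧
      ∃ zp zm : ℝ → ℝ,
        -- the part of the unstable manifold outside and on the horizon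
        (∀ x z : ℝ, 1 ≤ x → ((x, z) ∈ Michel.GammaPlus γ L p ↔ z = zp x)) ∧
        DifferentiableOn ℝ zp (Set.Ici 1) ∧
        HasDerivAt zp (Michel.slopePlus γ p) p.1 ∧
        (∀ x : ℝ, p.1 < x → Michel.LiesAbove (x, zp x) (Michel.c1 γ L)) ∧
        -- the stable manifold
        (∀ x z : ℝ, (x, z) ∈ Michel.GammaMinus γ L p ↔ 1 < x ∧ z = zm x) ∧
        DifferentiableOn ℝ zm (Set.Ioi 1) ∧
        HasDerivAt zm (Michel.slopeMinus γ p) p.1 ∧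
        Filter.Tendsto zm (nhdsWithin 1 (Set.Ioi 1)) Filter.atTop ∧
        (∀ x : ℝ, p.1 < x → Michel.LiesBelow (x, zm x) (Michel.c2 γ L)) ∧
        -- the global accretion flow along the unstable manifold
        (∃ (μ : ℝ) (u : ℝ → ℝ), μ < 0 ∧ μ ^ 2 = Michel.H γ L p.1 p.2 ∧
          Michel.IsGlobalAccretionFlow γ L μ zp u) ∧
        (∃ zinf : ℝ, 0 < zinf ∧ Michel.f γ zinf = L ∧
          Filter.Tendsto zp Filter.atTop (nhds zinf)) := by
  have hγ1 : 1 < γ := by linarith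
  obtain ⟨xc, zc, h⟩ := exists_isSonicPoint hγ hL
  have hxc := h.one_lt_x hγ1 hγ2
  have hp : (xc, zc) ∈ phaseSpace := ⟨by linarith [hxc], h.pos⟩
  have hHc := h.H_pos hγ1 hγ2
  have hex : ∀ x, ∃ z, 1 ≤ x → OnBranch γ L xc zc 1 x z := fun x => by
    rcases lt_trichotomy x 1 with hx | rfl | hx
    · exact ⟨0, fun hx' => absurd hx' hx.not_ge⟩
    · exact (h.exists_onBranch_horizon hγ1 hγ2 hL).imp fun _ hz _ => hz
    · exact (h.exists_onBranch_of_one_lt hγ1 hγ2 hL one_ne_zero hx).imp fun _ hz _ => hz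
  choose zp hzp using hex
  have hex : ∀ x, ∃ z, 1 < x → OnBranch γ L xc zc (-1) x z := fun x => by
    by_cases hx : 1 < x
    · exact (h.exists_onBranch_of_one_lt hγ1 hγ2 hL (by norm_num) hx).imp fun _ hz _ => hz
    · exact ⟨0, fun hx' => absurd hx' hx⟩
  choose zm hzm using hex
  have hslp : HasDerivAt zp (slopePlus γ (xc, zc)) xc := by
    have := OnBranch.hasDerivAt h hγ1 hγ2 hL (Or.inl rfl) fun x hx => hzp x hx.le
    rwa [one_mul] at this
  have hslm : HasDerivAt zm (slopeMinus γ (xc, zc)) xc := by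
    have := OnBranch.hasDerivAt h hγ1 hγ2 hL (Or.inr rfl) hzm
    rwa [neg_one_mul, ← sub_eq_add_neg] at this
  have hdp : DifferentiableOn ℝ zp (Ici 1) := fun x hx => by
    by_cases hne : x = xc
    · rw [hne]
      exact hslp.differentiableAt.differentiableWithinAt
    · exact OnBranch.differentiableWithinAt h hγ1 hγ2 hL
        (fun y hy => one_pos.trans_le (mem_Ici.1 hy)) hzp hx hne
  have hdm : DifferentiableOn ℝ zm (Ioi 1) := fun x hx => by
    by_cases hne : x = xc
    · rw [hne]
      exact hslm.differentiableAt.differentiableWithinAt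
    · exact OnBranch.differentiableWithinAt h hγ1 hγ2 hL
        (fun y hy => one_pos.trans (mem_Ioi.1 hy)) hzm hx hne
  have hV : ∀ q ∈ phaseSpace, hamField γ L q = (1 * Hz γ L q.1 q.2, -(1 * Hx γ L q.1 q.2)) :=
    fun q hq => by rw [hamField_eq hγ1 hq, one_mul, one_mul]
  have hV' : ∀ q ∈ phaseSpace, -hamField γ L q =
      (-1 * Hz γ L q.1 q.2, -(-1 * Hx γ L q.1 q.2)) := fun q hq => by
    rw [hamField_eq hγ1 hq, Prod.neg_mk, neg_one_mul, neg_one_mul]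
  refine ⟨(xc, zc), h.isSaddle hγ1 hγ2, fun q hq => h.eq_of_isCritical hγ1 hq, hxc,
    GammaPlus_eq hγ1 hp, GammaMinus_eq hγ1 hp, zp, zm, fun x z hx => ?_, hdp, hslp,
    fun x hx => (hzp x (hxc.trans hx).le).liesAbove_c1 h hγ1 hγ2 hL hx, fun x z => ?_, hdm, hslm,
    OnBranch.tendsto_horizon h hγ1 hγ2 hL hzm,
    fun x hx => (hzm x (hxc.trans hx)).liesBelow_c2 h hγ1 hγ2 hL hx,
    ⟨-Real.sqrt (H γ L xc zc), _, neg_lt_zero.2 (Real.sqrt_pos.2 hHc),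
      by rw [neg_sq, Real.sq_sqrt hHc.le],
      OnBranch.isGlobalAccretionFlow hHc.le hHc.ne' hzp hdp⟩,
    OnBranch.tendsto_infinity h hγ1 hγ2 hL hzp⟩
  · rw [GammaPlus_eq hγ1 hp]
    refine ⟨fun hmem => ?_, ?_⟩
    · have hb := onBranch_of_mem_stableManifold h hγ1 hγ2 hL one_ne_zero hV hmem
      exact hb.2.eq h hγ1 hγ2 hL hb.1.1 (hzp x hx)
    · rintro rfl
      exact mem_stableManifold_of_onBranch h hγ1 hγ2 hL hV (convex_Ici 1)
        (fun y hy => one_pos.trans_le (mem_Ici.1 hy)) hxc.le hzp hdp hslp.differentiableAt hx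
  · rw [GammaMinus_eq hγ1 hp, ← stableManifold_neg]
    refine ⟨fun hmem => ?_, ?_⟩
    · have hb := onBranch_of_mem_stableManifold h hγ1 hγ2 hL (by norm_num) hV' hmem
      have hx := hb.2.one_lt h hγ1 hγ2 hL hb.1.1
      exact ⟨hx, hb.2.eq h hγ1 hγ2 hL hb.1.1 (hzm x hx)⟩
    · rintro ⟨hx, rfl⟩
      exact mem_stableManifold_of_onBranch h hγ1 hγ2 hL hV' (convex_Ioi 1)
        (fun y hy => one_pos.trans (mem_Ioi.1 hy)) hxc hzm hdm hslm.differentiableAt hx
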